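/- Let $I=[0,1)$, identified with the circle $\mathbb S^1=\mathbb R/\mathbb Z$. For a multiplicative subgroup $\Lambda\subset\mathbb R_{>0}$ and an additive subgroup $A\subset\mathbb R$ with $1\in A$ and $\Lambda A\subset A$, let $T_{\Lambda,A}$ be the group of all bijections $f$ of $[0,1)$ that are homeomorphisms of the circle and for which there is a finite subdivision $0=a_1<a_2<\dots<a_m<a_{m+1}=1$ such that $f$ is affine with slope in $\Lambda$ on each $[a_i,a_{i+1})$, and $a_i\in A$, $f(a_i)\in A$ for $1\le i\le m$. Thompson's group $T_2$ is $T_{\Lambda,A}$ with $\Lambda=\langle 2\rangle$ and $A=\mathbb Z[1/2]$. For integers $1<n_1<\dots<n_p$ that generate a free abelian group $\Lambda=\langle n_1,\dots,n_p\rangle$ of rank $p$ in the multiplicative group of positive rationals, the Stein–Thompson group $T_{\{n_1,\dots,n_p\}}$ is $T_{\Lambda,A}$ with $A=\mathbb Z[\Lambda]$. A group $G$ is uniformly simple if there is a positive integer $N$ such that, for any two nontrivial elements $f,\phi\in G$, the element $\phi$ is a product of at most $N$ conjugates in $G$ of $f$ or $f^{-1}$. **Corollary 1.14.** Thompson's group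 $T_2$ is uniformly simple. If $p\ge 2$ and $1<n_1<\dots<n_p$ are integers as above with $n_2=n_1^{2k}-1$ for some integer $k\ge 1$, then the Stein–Thompson group $T_{\{n_1,\dots,n_p\}}$ is uniformly simple. In particular, every Stein–Thompson group $T_{\{2,3,n_3,\dots,n_p\}}$ is uniformly simple. -/

import Mathlib

/-- A group is `N`-uniformly simple if, for any two nontrivial elements `f` and `φ`, the element
`φ` is a product of at most `N` conjugates of `f` or `f⁻¹`. -/
def IsNUniformlySimple (N : ℕ) (G : Type*) [Group G] : Prop :=
  ∀ f φ : G, f ≠ 1 → φ ≠ 1 →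
    ∃ l : List G, l.length ≤ N ∧ (∀ x ∈ l, IsConj f x ∨ IsConj f⁻¹ x) ∧ l.prod = φ

/-- A group is uniformly simple if it is `N`-uniformly simple for some positive integer `N`. -/
def IsUniformlySimple (G : Type*) [Group G] : Prop :=
  ∃ N : ℕ, 0 < N ∧ IsNUniformlySimple N G

/-- The interval `I = [0,1)`. -/
abbrev UnitIco : Type := Set.Ico (0 : ℝ) 1

/-- The multiplicative group of positive real numbers. -/
abbrev PosReal : Type := {r : ℝ // 0 < r}

/-- A multiplicative group `Λ` of positive reals (the allowed slopes) together with an additive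
group `A` of reals (the allowed break points) that is stable under multiplication by `Λ` and
contains `1`. -/
structure SlopeData where
  Λ : Subgroup PosReal
  A : AddSubgroup ℝ
  smul_mem : ∀ c ∈ Λ, ∀ a ∈ A, (c : ℝ) * a ∈ A
  one_mem : (1 : ℝ) ∈ A

/-- The bijection `f` of `[0,1)` is affine on `[u,v)`, with slope in `Λ`. -/
def IsAffineOnIco (Λ : Subgroup PosReal) (f : Equiv.Perm UnitIco) (u v : ℝ) : Prop :=
  ∃ c ∈ Λ, ∃ b : ℝ, ∀ x : UnitIco, u ≤ (x : ℝ) → (x : ℝ) < v → (f x : ℝ) = (c : ℝ) * x + b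

/-- The bijection `f` of `[0,1)` is an affine interval exchange with slopes in `Λ`, and with break
points and their images in `A`. Here `S` is the set of left endpoints `0 = a₁ < ⋯ < a_m` of a
subdivision of `[0,1)`, and `f` is affine on each half-open interval `[u,v)` that has no
point of `S` in its interior, that is, on each `[a_i, a_{i+1})`, where `a_{m+1} = 1`. -/
def IsAffineExchange (D : SlopeData) (f : Equiv.Perm UnitIco) : Prop :=
  ∃ S : Finset UnitIco,
    (∃ s ∈ S, (s : ℝ) = 0) ∧
    (∀ s ∈ S, (s : ℝ) ∈ D.A ∧ (f s : ℝ) ∈ D.A) ∧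
    ∀ u v : ℝ, 0 ≤ u → u < v → v ≤ 1 → (∀ s ∈ S, ¬ (u < (s : ℝ) ∧ (s : ℝ) < v)) →
      IsAffineOnIco D.Λ f u v

/-- Every point lies in a piece of the subdivision, whose left endpoint belongs to `S`. -/
theorem exists_piece (S : Finset UnitIco) (h0 : ∃ s ∈ S, (s : ℝ) = 0) (x : UnitIco) :
    ∃ a ∈ S, ∃ b : ℝ, (a : ℝ) ≤ x ∧ (x : ℝ) < b ∧ b ≤ 1 ∧
      (∀ s ∈ S, ¬ ((a : ℝ) < s ∧ (s : ℝ) < b)) ∧ (b < 1 → ∃ s ∈ S, (s : ℝ) = b) := by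
  classical
  obtain ⟨s0, hs0, hs00⟩ := h0
  have hne : (S.filter (fun s => s ≤ x)).Nonempty :=
    ⟨s0, by
      rw [Finset.mem_filter]
      exact ⟨hs0, by rw [← Subtype.coe_le_coe, hs00]; exact x.2.1⟩⟩
  obtain ⟨a, ha, hamax⟩ := Finset.exists_max_image _ (fun s : UnitIco => (s : ℝ)) hne
  rw [Finset.mem_filter] at ha
  by_cases hne' : (S.filter (fun s => x < s)).Nonempty
  · obtain ⟨b, hb, hbmin⟩ := Finset.exists_min_image _ (fun s : UnitIco => (s : ℝ)) hne'
    rw [Finset.mem_filter] at hb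
    refine ⟨a, ha.1, b, ha.2, hb.2, b.2.2.le, ?_, fun _ => ⟨b, hb.1, rfl⟩⟩
    rintro s hs ⟨h1, h2⟩
    rcases le_or_gt s x with h | h
    · exact absurd (hamax s (Finset.mem_filter.2 ⟨hs, h⟩)) (not_le.2 h1)
    · exact absurd (hbmin s (Finset.mem_filter.2 ⟨hs, h⟩)) (not_le.2 h2)
  · refine ⟨a, ha.1, 1, ha.2, x.2.2, le_refl _, ?_, fun h => absurd h (lt_irrefl _)⟩
    rintro s hs ⟨h1, h2⟩
    rcases le_or_gt s x with h | h
    · exact absurd (hamax s (Finset.mem_filter.2 ⟨hs, h⟩)) (not_le.2 h1)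
    · exact hne' ⟨s, Finset.mem_filter.2 ⟨hs, h⟩⟩

theorem IsAffineExchange.one (D : SlopeData) : IsAffineExchange D 1 := by
  refine ⟨{⟨0, by simp⟩}, ⟨_, Finset.mem_singleton_self _, rfl⟩, ?_, ?_⟩
  · intro s hs
    rw [Finset.mem_singleton] at hs
    subst hs
    exact ⟨D.A.zero_mem, D.A.zero_mem⟩
  · intro u v _ _ _ _
    exact ⟨1, D.Λ.one_mem, 0, fun x _ _ => by simp⟩

/-- A point whose image lies in `A` lies in `A`. -/
theorem IsAffineExchange.mem_of_image_mem {D : SlopeData} {f : Equiv.Perm UnitIco}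
    (hf : IsAffineExchange D f) (x : UnitIco) (hx : (f x : ℝ) ∈ D.A) : (x : ℝ) ∈ D.A := by
  obtain ⟨S, h0, hA, haff⟩ := hf
  obtain ⟨a, haS, b, hax, hxb, hb1, hS, hbS⟩ := exists_piece S h0 x
  obtain ⟨c, hc, d, hcd⟩ := haff a b a.2.1 (lt_of_le_of_lt hax hxb) hb1 hS
  have e1 := hcd x hax hxb
  have e2 := hcd a le_rfl (lt_of_le_of_lt hax hxb)
  have hcpos : (c : ℝ) ≠ 0 := c.2.ne'
  have e3 : (x : ℝ) = a + ((c⁻¹ : PosReal) : ℝ) * ((f x : ℝ) - f a) := by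
    rw [e1, e2, Positive.coe_inv]
    field_simp
    ring
  rw [e3]
  exact D.A.add_mem (hA a haS).1
    (D.smul_mem _ (D.Λ.inv_mem hc) _ (D.A.sub_mem hx (hA a haS).2))

/-- Points of `A` are sent to points of `A`. -/
theorem IsAffineExchange.image_mem {D : SlopeData} {f : Equiv.Perm UnitIco}
    (hf : IsAffineExchange D f) (x : UnitIco) (hx : (x : ℝ) ∈ D.A) : (f x : ℝ) ∈ D.A := by
  obtain ⟨S, h0, hA, haff⟩ := hf
  obtain ⟨a, haS, b, hax, hxb, hb1, hS, hbS⟩ := exists_piece S h0 x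
  obtain ⟨c, hc, d, hcd⟩ := haff a b a.2.1 (lt_of_le_of_lt hax hxb) hb1 hS
  have e1 := hcd x hax hxb
  have e2 := hcd a le_rfl (lt_of_le_of_lt hax hxb)
  have e3 : (f x : ℝ) = f a + (c : ℝ) * ((x : ℝ) - a) := by
    rw [e1, e2]; ring
  rw [e3]
  exact D.A.add_mem (hA a haS).2 (D.smul_mem _ hc _ (D.A.sub_mem hx (hA a haS).1))

theorem IsAffineExchange.mul {D : SlopeData} {f g : Equiv.Perm UnitIco}
    (hf : IsAffineExchange D f) (hg : IsAffineExchange D g) : IsAffineExchange D (f * g) := by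
  classical
  have hg' := hg
  have hf' := hf
  obtain ⟨S, h0, hA, haff⟩ := hf
  obtain ⟨S', h0', hA', haff'⟩ := hg
  refine ⟨S' ∪ S.image (fun s => g⁻¹ s), ?_, ?_, ?_⟩
  · obtain ⟨s, hs, hs0⟩ := h0'
    exact ⟨s, Finset.mem_union_left _ hs, hs0⟩
  · intro s hs
    rw [Finset.mem_union, Finset.mem_image] at hs
    have hsA : (s : ℝ) ∈ D.A := by
      rcases hs with hs | ⟨t, ht, rfl⟩
      · exact (hA' s hs).1
      · apply hg'.mem_of_image_mem
        simpa using (hA t ht).1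
    exact ⟨hsA, hf'.image_mem _ (hg'.image_mem _ hsA)⟩
  · intro u v hu huv hv hmiss
    obtain ⟨c, hc, d, hcd⟩ := haff' u v hu huv hv
      (fun s hs => hmiss s (Finset.mem_union_left _ hs))
    have hcpos : 0 < (c : ℝ) := c.2
    have hu' : 0 ≤ (c : ℝ) * u + d := by
      rw [← hcd ⟨u, hu, huv.trans_le hv⟩ le_rfl huv]
      exact (g _).2.1
    have hv' : (c : ℝ) * v + d ≤ 1 := by
      by_contra hcon
      push Not at hcon
      set w : ℝ := max u ((1 - d) / c) with hw
      have hwv : w < v := by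
        rw [hw, max_lt_iff, div_lt_iff₀ hcpos]
        exact ⟨huv, by linarith⟩
      have h1 := hcd ⟨w, hu.trans (le_max_left _ _), hwv.trans_le hv⟩ (le_max_left _ _) hwv
      have h2 := (g ⟨w, hu.trans (le_max_left _ _), hwv.trans_le hv⟩).2.2
      rw [h1] at h2
      have h3 : (1 - d) / c ≤ w := le_max_right _ _
      rw [div_le_iff₀ hcpos] at h3
      simp only at h2
      linarith
    obtain ⟨c', hc', d', hcd'⟩ := haff (c * u + d) (c * v + d) hu'
      (by have := mul_lt_mul_of_pos_left huv hcpos; linarith) hv' (by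
        rintro s hs ⟨h1, h2⟩
        have hy1 : u < ((s : ℝ) - d) / c := by rw [lt_div_iff₀ hcpos]; linarith
        have hy2 : ((s : ℝ) - d) / c < v := by rw [div_lt_iff₀ hcpos]; linarith
        set y : UnitIco := ⟨((s : ℝ) - d) / c, hu.trans hy1.le, hy2.trans_le hv⟩ with hy
        have hgy : g y = s := by
          apply Subtype.ext
          rw [hcd y hy1.le hy2, hy]
          simp only
          field_simp
          ring
        refine hmiss y (Finset.mem_union_right _ (Finset.mem_image.2 ⟨s, hs, ?_⟩)) ⟨hy1, hy2⟩
        rw [← hgy]; simp)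
    refine ⟨c' * c, D.Λ.mul_mem hc' hc, c' * d + d', ?_⟩
    intro x hux hxv
    have h1 := hcd x hux hxv
    have h2 := hcd' (g x) (by rw [h1]; have := mul_le_mul_of_nonneg_left hux hcpos.le; linarith)
      (by rw [h1]; have := mul_lt_mul_of_pos_left hxv hcpos; linarith)
    rw [Equiv.Perm.mul_apply, h2, h1, Positive.val_mul]
    ring

theorem IsAffineExchange.inv {D : SlopeData} {f : Equiv.Perm UnitIco}
    (hf : IsAffineExchange D f) : IsAffineExchange D f⁻¹ := by
  classical
  obtain ⟨S, h0, hA, haff⟩ := hf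
  refine ⟨S.image f, ?_, ?_, ?_⟩
  · obtain ⟨a, haS, b, hax, hxb, hb1, hS, hbS⟩ := exists_piece S h0 (f⁻¹ ⟨0, by simp⟩)
    obtain ⟨c, hc, d, hcd⟩ := haff a b a.2.1 (lt_of_le_of_lt hax hxb) hb1 hS
    have hcpos : 0 < (c : ℝ) := c.2
    have e1 := hcd _ hax hxb
    have e2 := hcd a le_rfl (lt_of_le_of_lt hax hxb)
    have h3 := (f a).2.1
    have h4 : (f (f⁻¹ ⟨0, by simp⟩) : ℝ) = 0 := by simp
    have := mul_le_mul_of_nonneg_left hax hcpos.le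
    exact ⟨f a, Finset.mem_image_of_mem _ haS, by linarith⟩
  · intro t ht
    obtain ⟨s, hs, rfl⟩ := Finset.mem_image.1 ht
    exact ⟨(hA s hs).2, by simpa using (hA s hs).1⟩
  · intro u v hu huv hv hmiss
    obtain ⟨a, haS, b, hax, hxb, hb1, hS, hbS⟩ := exists_piece S h0 (f⁻¹ ⟨u, hu, huv.trans_le hv⟩)
    have hab := lt_of_le_of_lt hax hxb
    obtain ⟨c, hc, d, hcd⟩ := haff a b a.2.1 hab hb1 hS
    have hcpos : 0 < (c : ℝ) := c.2
    have e1 := hcd _ hax hxb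
    have e2 := hcd a le_rfl hab
    have e0 : (f (f⁻¹ ⟨u, hu, huv.trans_le hv⟩) : ℝ) = u := by simp
    rw [e0] at e1
    have hau : (f a : ℝ) ≤ u := by
      have := mul_le_mul_of_nonneg_left hax hcpos.le; linarith
    have hub : u < c * b + d := by
      have := mul_lt_mul_of_pos_left hxb hcpos; linarith
    have hvb : v ≤ c * b + d := by
      by_contra hcon
      push Not at hcon
      set w : UnitIco := ⟨c * b + d, hu.trans hub.le, hcon.trans_le hv⟩ with hw
      obtain ⟨a', haS', b', hax', hxb', hb1', hS', -⟩ := exists_piece S h0 (f⁻¹ w)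
      obtain ⟨c', hc', d', hcd'⟩ := haff a' b' a'.2.1 (lt_of_le_of_lt hax' hxb') hb1' hS'
      have hcpos' : 0 < (c' : ℝ) := c'.2
      have hfw : (f (f⁻¹ w) : ℝ) = c * b + d := by simp [hw]
      have e1' := hcd' _ hax' hxb'
      rw [hfw] at e1'
      rcases eq_or_lt_of_le hax' with h | h
      · -- the point `w` would be the image of a break point
        have h' : a' = f⁻¹ w := Subtype.ext h
        refine hmiss w (Finset.mem_image.2 ⟨a', haS', by rw [h']; simp⟩) ⟨hub, hcon⟩
      · -- otherwise the piece of `f⁻¹ w` overlaps `[a, b)`, hence is `[a, b)`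
        set y : ℝ := ((f⁻¹ w : UnitIco) : ℝ) with hy
        obtain ⟨ε, hε, hε1, hε2⟩ : ∃ ε : ℝ, 0 < ε ∧ c' * ε ≤ c * (b - a) ∧ ε ≤ y - a' := by
          refine ⟨min (c * (b - a) / c') (y - a'), ?_, ?_, min_le_right _ _⟩
          · apply lt_min
            · exact div_pos (mul_pos hcpos (sub_pos.2 hab)) hcpos'
            · linarith
          · have := min_le_left (c * (b - a) / c') (y - a')
            rw [le_div_iff₀ hcpos'] at this
            linarith
        have ha'0 : 0 ≤ (a' : ℝ) := a'.2.1
        have ha0 : 0 ≤ (a : ℝ) := a.2.1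
        have hεc : 0 < c' * ε / c := div_pos (mul_pos hcpos' hε) hcpos
        have hεc' : c' * ε / c ≤ b - a := by rw [div_le_iff₀ hcpos]; linarith
        set p : UnitIco := ⟨y - ε, by linarith, by linarith⟩ with hp
        set q : UnitIco := ⟨b - c' * ε / c, by linarith, by linarith⟩ with hq
        have hpv : (p : ℝ) = y - ε := rfl
        have hqv : (q : ℝ) = b - c' * ε / c := rfl
        have hfp := hcd' p (by linarith) (by linarith)
        have hfq := hcd q (by linarith) (by linarith)
        have hcc : (c : ℝ) * (c' * ε / c) = c' * ε := by field_simp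
        have hpq : p = q := by
          apply f.injective
          apply Subtype.ext
          rw [hfp, hfq, hpv, hqv]
          linarith
        have hpa : (a : ℝ) ≤ p := by rw [hpq]; linarith
        have hpb : (p : ℝ) < b := by rw [hpq]; linarith
        have hpa' : (a' : ℝ) ≤ p := by linarith
        rcases lt_or_ge y b with hyb | hyb
        · have := hcd (f⁻¹ w) (by linarith) hyb
          rw [hfw] at this
          have h5 := mul_lt_mul_of_pos_left hyb hcpos
          linarith
        · obtain ⟨t, ht, htb⟩ := hbS (by linarith)
          exact hS' t ht ⟨by linarith, by linarith⟩
    refine ⟨c⁻¹, D.Λ.inv_mem hc, -(((c⁻¹ : PosReal) : ℝ) * d), ?_⟩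
    intro x hux hxv
    have hz1 : (a : ℝ) ≤ ((x : ℝ) - d) / c := by rw [le_div_iff₀ hcpos]; linarith
    have hz2 : ((x : ℝ) - d) / c < b := by rw [div_lt_iff₀ hcpos]; linarith
    have hz3 := a.2.1
    set z : UnitIco := ⟨((x : ℝ) - d) / c, hz3.trans hz1, hz2.trans_le hb1⟩ with hz
    have hfz : f z = x := by
      apply Subtype.ext
      rw [hcd z hz1 hz2, hz]
      simp only
      field_simp
      ring
    rw [show f⁻¹ x = z by rw [← hfz]; simp, hz, Positive.coe_inv]
    simp only
    field_simp
    ring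

/-- The group `V_{Λ,A}` of affine interval exchanges of `[0,1)` with slopes in `Λ` and with break
points and their images in `A`. -/
noncomputable def bieriStrebelV (D : SlopeData) : Subgroup (Equiv.Perm UnitIco) where
  carrier := {f | IsAffineExchange D f}
  mul_mem' := IsAffineExchange.mul
  one_mem' := IsAffineExchange.one D
  inv_mem' := IsAffineExchange.inv

/-- No restriction on slopes and break points. -/
noncomputable def fullSlopeData : SlopeData where
  Λ := ⊤
  A := ⊤
  smul_mem := fun _ _ _ _ => AddSubgroup.mem_top _
  one_mem := AddSubgroup.mem_top _

/-- The group `𝒜⁺(I)` of affine interval exchange transformations of `[0,1)`. -/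
noncomputable def affineExchangeGroup : Subgroup (Equiv.Perm UnitIco) := bieriStrebelV fullSlopeData

/-- The identification of the circle `ℝ/ℤ` with `[0,1)`. -/
noncomputable def circleEquivIco : UnitAddCircle ≃ UnitIco :=
  (AddCircle.equivIco (1 : ℝ) 0).trans (Equiv.setCongr (by rw [zero_add]))

/-- The inverse of the identification is reduction modulo `1`. -/
theorem circleEquivIco_symm_apply (x : UnitIco) :
    circleEquivIco.symm x = ((x : ℝ) : UnitAddCircle) := rfl

/-- A bijection of `[0,1)`, seen as a bijection of the circle. -/
noncomputable def toCirclePerm : Equiv.Perm UnitIco ≃* Equiv.Perm UnitAddCircle :=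
  circleEquivIco.symm.permCongrHom

/-- The group of the bijections of `[0,1)` that are homeomorphisms of the circle. -/
noncomputable def circleHomeoGroup : Subgroup (Equiv.Perm UnitIco) where
  carrier := {f | Continuous (toCirclePerm f) ∧ Continuous (toCirclePerm f⁻¹)}
  mul_mem' := by
    rintro f g ⟨hf, hf'⟩ ⟨hg, hg'⟩
    refine ⟨?_, ?_⟩
    · rw [map_mul]; exact hf.comp hg
    · rw [mul_inv_rev, map_mul]; exact hg'.comp hf'
  one_mem' := by
    refine ⟨?_, ?_⟩
    · rw [map_one]; exact continuous_id
    · rw [inv_one, map_one]; exact continuous_id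
  inv_mem' := by
    rintro f ⟨hf, hf'⟩
    exact ⟨hf', by rwa [inv_inv]⟩

/-- The group `PL⁺(𝕊¹)` of orientation preserving piecewise affine homeomorphisms of the circle:
the affine interval exchanges that are homeomorphisms of the circle. -/
noncomputable def plCircleGroup : Subgroup (Equiv.Perm UnitIco) :=
  affineExchangeGroup ⊓ circleHomeoGroup

/-- The Bieri-Strebel group `T_{Λ,A} = PL⁺(𝕊¹) ∩ V_{Λ,A}`. -/
noncomputable def bieriStrebelT (D : SlopeData) : Subgroup (Equiv.Perm UnitIco) :=
  plCircleGroup ⊓ bieriStrebelV D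

/-- The slope group `⟨n₁, …, n_p⟩` together with `A = ℤ[⟨n₁, …, n_p⟩]`. -/
noncomputable def steinSlopeData {p : ℕ} (n : Fin p → ℕ) : SlopeData where
  Λ := Subgroup.closure {c : PosReal | ∃ i, (c : ℝ) = n i}
  A := (Subring.closure {x : ℝ | ∃ c ∈ Subgroup.closure {c : PosReal | ∃ i, (c : ℝ) = n i},
    x = (c : ℝ)}).toAddSubgroup
  smul_mem := by
    intro c hc a ha
    exact Subring.mul_mem _ (Subring.subset_closure ⟨c, hc, rfl⟩) ha
  one_mem := Subring.one_mem _

/-- The slope group `⟨m⟩` together with `A = ℤ[1/m]`. -/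
noncomputable def brownSlopeData (m : ℕ) : SlopeData where
  Λ := Subgroup.closure {c : PosReal | (c : ℝ) = m}
  A := (Subring.closure {(1 / m : ℝ)}).toAddSubgroup
  smul_mem := by
    intro c hc a ha
    refine Subring.mul_mem _ ?_ ha
    suffices h : (c : ℝ) ∈ Subring.closure {(1 / m : ℝ)} ∧
        ((c⁻¹ : PosReal) : ℝ) ∈ Subring.closure {(1 / m : ℝ)} from h.1
    induction hc using Subgroup.closure_induction with
    | mem x hx =>
      have hx' : (x : ℝ) = m := hx
      rw [Positive.coe_inv, hx', ← one_div]
      exact ⟨natCast_mem _ m, Subring.subset_closure rfl⟩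
    | one => simp
    | mul x y _ _ hx hy =>
      rw [mul_inv, Positive.val_mul, Positive.val_mul]
      exact ⟨Subring.mul_mem _ hx.1 hy.1, Subring.mul_mem _ hx.2 hy.2⟩
    | inv x _ hx => exact ⟨hx.2, by rw [inv_inv]; exact hx.1⟩
  one_mem := Subring.one_mem _

/-- The Brown-Thompson group `T_m`; for `m = 2` it is Thompson's group `T`. -/
noncomputable def brownThompsonT (m : ℕ) : Subgroup (Equiv.Perm UnitIco) :=
  bieriStrebelT (brownSlopeData m)

/-- The integers `1 < n₁ < ⋯ < n_p` generate a free abelian group of rank `p` in the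
multiplicative group of positive rationals: they satisfy no nontrivial multiplicative relation. -/
def IsSteinTuple {p : ℕ} (n : Fin p → ℕ) : Prop :=
  (∀ i, 1 < n i) ∧ StrictMono n ∧
    ∀ e : Fin p → ℤ, (∏ i, (n i : ℚ) ^ e i) = 1 → e = 0

/-- The Stein-Thompson group `T_{n₁, …, n_p}`. -/
noncomputable def steinThompsonT {p : ℕ} (n : Fin p → ℕ) : Subgroup (Equiv.Perm UnitIco) :=
  bieriStrebelT (steinSlopeData n)

/-! The proof gives an explicit bound: 32 conjugates suffice in every `T_{Λ,A}` satisfying two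
conditions. (1) `HasUnitSlope`: some `l > 1` in `Λ` has `l - 1` acting invertibly on `A`. (2)
`IsLocallyCyclic`: elements of `A` have common divisors in `A`. For `T_2` take `l = 2`. In the Stein
case take `l = n₁^{2k}`, since `l - 1 = n₂` is itself a slope. Condition (2) holds because `A`
consists of fractions over powers of one integer.

Condition (1) lets a piecewise affine map take any two points of `A` to any two points of `A` in the
same order. Elements can therefore be cut off, squeezed and conjugated into small intervals.

The main algebraic point is that the group `B` of piecewise affine homeomorphisms of the line with
bounded support is perfect (`boundedGroup_perfect`). Modulo `[B,B]`, the image of `B` is central.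
Any map that is the identity near `-∞` is a product of one-break maps. Central images drop out of
commutators, so translations have canonical lifts, additive by (2), and the image of such a map is
determined by its affine germ at `+∞` (`map_eq_of_hasEnds`). Elements of `B` have the germ of the
identity, so their image is trivial. A displacement argument then writes each element of `B` as a
product of two commutators (`exists_two_commutators`), and squeezing does the same for maps
supported inside `(0,1)`.

On the circle, a nontrivial `f` displaces an interval. If `g` and `h` are supported in it, then
`[g,h] = [[g,f],h]` is a product of four conjugates of `f` and `f⁻¹`. The bound then doubles at each
stage: 4 for such a commutator, 8 for a map supported inside `(0,1)`, 16 for a map fixing `0` (after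
correcting its germ at `0`), and 32 for an arbitrary element (after moving one point). -/

open Filter Topology Set
open scoped commutatorElement

/-! ### Piecewise affine homeomorphisms of the line, through their germs -/

/-- Along the filter `l`, the function `f` is affine with slope in `Λ` and intercept in `A`. -/
def AffineGerm (D : SlopeData) (l : Filter ℝ) (f : ℝ → ℝ) : Prop :=
  ∃ c ∈ D.Λ, ∃ b ∈ D.A, ∀ᶠ y in l, f y = (c : ℝ) * y + b

namespace AffineGerm

variable {D : SlopeData} {l l' : Filter ℝ} {f g : ℝ → ℝ}

theorem congr (h : AffineGerm D l f) (hfg : ∀ᶠ y in l, f y = g y) : AffineGerm D l g := by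
  obtain ⟨c, hc, b, hb, h⟩ := h
  refine ⟨c, hc, b, hb, ?_⟩
  filter_upwards [h, hfg] with y h1 h2
  rw [← h2, h1]

theorem id : AffineGerm D l (fun x => x) :=
  ⟨1, D.Λ.one_mem, 0, D.A.zero_mem, by simp⟩

theorem comp (hf : AffineGerm D l' f) (hg : AffineGerm D l g) (ht : Tendsto g l l') :
    AffineGerm D l (fun x => f (g x)) := by
  obtain ⟨c, hc, b, hb, h⟩ := hf
  obtain ⟨c', hc', b', hb', h'⟩ := hg
  refine ⟨c * c', D.Λ.mul_mem hc hc', c * b' + b, D.A.add_mem (D.smul_mem _ hc _ hb') hb, ?_⟩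
  filter_upwards [ht.eventually h, h'] with y h1 h2
  rw [h1, h2, Positive.val_mul]
  ring

theorem symm {e : ℝ ≃o ℝ} (h : AffineGerm D l e) (ht : Tendsto e.symm l' l) :
    AffineGerm D l' e.symm := by
  obtain ⟨c, hc, b, hb, h⟩ := h
  refine ⟨c⁻¹, D.Λ.inv_mem hc, -(((c⁻¹ : PosReal) : ℝ) * b),
    D.A.neg_mem (D.smul_mem _ (D.Λ.inv_mem hc) _ hb), ?_⟩
  filter_upwards [ht.eventually h] with y h1
  rw [OrderIso.apply_symm_apply] at h1
  have := c.2.ne'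
  rw [Positive.coe_inv]
  field_simp
  linarith

end AffineGerm

theorem OrderIso.tendsto_nhdsGE (f : ℝ ≃o ℝ) (x : ℝ) : Tendsto f (𝓝[≥] x) (𝓝[≥] (f x)) :=
  tendsto_nhdsWithin_of_tendsto_nhds_of_eventually_within _
    (f.continuous.continuousAt.tendsto.mono_left nhdsWithin_le_nhds)
    (eventually_mem_nhdsWithin.mono fun _ hy => f.monotone hy)

theorem OrderIso.tendsto_nhdsLE (f : ℝ ≃o ℝ) (x : ℝ) : Tendsto f (𝓝[≤] x) (𝓝[≤] (f x)) :=
  tendsto_nhdsWithin_of_tendsto_nhds_of_eventually_within _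
    (f.continuous.continuousAt.tendsto.mono_left nhdsWithin_le_nhds)
    (eventually_mem_nhdsWithin.mono fun _ hy => f.monotone hy)

/-- Piecewise affine homeomorphisms of the line with slopes in `Λ` and breaks in `A`, described by
their germs. -/
def IsPL (D : SlopeData) (f : ℝ ≃o ℝ) : Prop :=
  ∀ x, AffineGerm D (𝓝[≥] x) f ∧ AffineGerm D (𝓝[≤] x) f ∧ (x ∉ D.A → AffineGerm D (𝓝 x) f)

namespace IsPL

variable {D : SlopeData} {f g : ℝ ≃o ℝ}

theorem apply_mem_iff (hf : IsPL D f) {x : ℝ} : f x ∈ D.A ↔ x ∈ D.A := by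
  obtain ⟨c, hc, b, hb, h⟩ := (hf x).1
  have hx : f x = c * x + b := h.self_of_nhdsWithin self_mem_Ici
  constructor
  · intro h
    have h1 := D.smul_mem _ (D.Λ.inv_mem hc) _ (D.A.sub_mem h hb)
    have := c.2.ne'
    rwa [hx, Positive.coe_inv, add_sub_cancel_right, inv_mul_cancel_left₀ this] at h1
  · intro h
    rw [hx]
    exact D.A.add_mem (D.smul_mem _ hc _ h) hb

theorem one : IsPL D 1 := fun _ => ⟨AffineGerm.id, AffineGerm.id, fun _ => AffineGerm.id⟩

theorem mul (hf : IsPL D f) (hg : IsPL D g) : IsPL D (f * g) := fun x =>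
  ⟨(hf (g x)).1.comp (hg x).1 (g.tendsto_nhdsGE x),
   (hf (g x)).2.1.comp (hg x).2.1 (g.tendsto_nhdsLE x),
   fun hx => ((hf (g x)).2.2 (fun h => hx (hg.apply_mem_iff.1 h))).comp ((hg x).2.2 hx)
    g.continuous.continuousAt⟩

theorem inv (hf : IsPL D f) : IsPL D f⁻¹ := fun x => by
  have hx : f (f.symm x) = x := f.apply_symm_apply x
  refine ⟨(hf (f.symm x)).1.symm (f.symm.tendsto_nhdsGE x),
    (hf (f.symm x)).2.1.symm (f.symm.tendsto_nhdsLE x), fun h => ?_⟩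
  refine ((hf (f.symm x)).2.2 fun h' => h ?_).symm f.symm.continuous.continuousAt
  rw [← hx]
  exact hf.apply_mem_iff.2 h'

end IsPL

/-- The group of piecewise affine homeomorphisms of the line. -/
def plGroup (D : SlopeData) : Subgroup (ℝ ≃o ℝ) where
  carrier := {f | IsPL D f}
  mul_mem' := IsPL.mul
  one_mem' := IsPL.one
  inv_mem' := IsPL.inv

/-! ### Affine maps, gluing, and maps with one break -/

/-- The affine map `x ↦ c x + b`. -/
noncomputable def affineIso (c : PosReal) (b : ℝ) : ℝ ≃o ℝ where
  toFun x := c * x + b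
  invFun y := (y - b) / c
  left_inv x := by have := c.2.ne'; field_simp; ring
  right_inv x := by have := c.2.ne'; field_simp; ring
  map_rel_iff' := by
    intro x y
    have := c.2
    simp [this]

@[simp] theorem affineIso_apply (c : PosReal) (b x : ℝ) : affineIso c b x = c * x + b := rfl

theorem affineIso_mem {D : SlopeData} {c : PosReal} (hc : c ∈ D.Λ) {b : ℝ} (hb : b ∈ D.A) :
    affineIso c b ∈ plGroup D := fun _ =>
  ⟨⟨c, hc, b, hb, by simp⟩, ⟨c, hc, b, hb, by simp⟩, fun _ => ⟨c, hc, b, hb, by simp⟩⟩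

/-- The homeomorphism that is `f` to the left of `m` and `g` to the right of `m`. -/
noncomputable def glueIso (f g : ℝ ≃o ℝ) (m : ℝ) (h : f m = g m) : ℝ ≃o ℝ :=
  StrictMono.orderIsoOfSurjective (fun x => if x ≤ m then f x else g x)
    (by
      intro x y hxy
      dsimp only
      split_ifs with h1 h2 h2
      · exact f.strictMono hxy
      · have := f.monotone h1
        have := g.strictMono (not_le.1 h2)
        linarith
      · linarith
      · exact g.strictMono hxy)
    (by
      intro y
      rcases le_or_gt y (f m) with hy | hy
      · exact ⟨f.symm y, by
          beta_reduce
          rw [if_pos ((f.symm_apply_le).2 hy), OrderIso.apply_symm_apply]⟩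
      · exact ⟨g.symm y, by
          beta_reduce
          rw [if_neg (not_le.2 ((g.lt_symm_apply).2 (h ▸ hy))), OrderIso.apply_symm_apply]⟩)

section glue

variable {f g : ℝ ≃o ℝ} {m : ℝ} {h : f m = g m} {x : ℝ}

theorem glueIso_of_le (hx : x ≤ m) : glueIso f g m h x = f x := by
  exact if_pos hx

theorem glueIso_of_ge (hx : m ≤ x) : glueIso f g m h x = g x := by
  rcases hx.eq_or_lt with rfl | hx
  · rw [glueIso_of_le le_rfl, h]
  · exact if_neg (not_le.2 hx)

theorem glueIso_mem {D : SlopeData} (hf : f ∈ plGroup D) (hg : g ∈ plGroup D) (hm : m ∈ D.A) :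
    glueIso f g m h ∈ plGroup D := by
  intro x
  rcases lt_trichotomy x m with hx | rfl | hx
  · have : ∀ᶠ y in 𝓝 x, f y = glueIso f g m h y := by
      filter_upwards [eventually_lt_nhds hx] with y hy
      rw [glueIso_of_le hy.le]
    exact ⟨(hf x).1.congr (this.filter_mono nhdsWithin_le_nhds),
      (hf x).2.1.congr (this.filter_mono nhdsWithin_le_nhds), fun h => ((hf x).2.2 h).congr this⟩
  · refine ⟨(hg x).1.congr ?_, (hf x).2.1.congr ?_, fun h => absurd hm h⟩
    · filter_upwards [self_mem_nhdsWithin] with y hy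
      rw [glueIso_of_ge hy]
    · filter_upwards [self_mem_nhdsWithin] with y hy
      rw [glueIso_of_le hy]
  · have : ∀ᶠ y in 𝓝 x, g y = glueIso f g m h y := by
      filter_upwards [eventually_gt_nhds hx] with y hy
      rw [glueIso_of_ge hy.le]
    exact ⟨(hg x).1.congr (this.filter_mono nhdsWithin_le_nhds),
      (hg x).2.1.congr (this.filter_mono nhdsWithin_le_nhds), fun h => ((hg x).2.2 h).congr this⟩

end glue

/-- The map that is the identity to the left of `p` and has slope `c` to the right of `p`. -/
noncomputable def bendIso (p : ℝ) (c : PosReal) : ℝ ≃o ℝ :=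
  glueIso 1 (affineIso c (p - c * p)) p (by simp)

section bend

variable {D : SlopeData} {p x : ℝ} {c c' : PosReal}

theorem bendIso_of_le (hx : x ≤ p) : bendIso p c x = x := glueIso_of_le hx

theorem bendIso_of_ge (hx : p ≤ x) : bendIso p c x = c * x + (p - c * p) := glueIso_of_ge hx

theorem bendIso_mem (hc : c ∈ D.Λ) (hp : p ∈ D.A) : bendIso p c ∈ plGroup D :=
  glueIso_mem (plGroup D).one_mem
    (affineIso_mem hc (D.A.sub_mem hp (D.smul_mem _ hc _ hp))) hp

theorem bendIso_mul : bendIso p c * bendIso p c' = bendIso p (c * c') := by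
  ext x
  rw [RelIso.mul_apply]
  rcases le_total x p with hx | hx
  · rw [bendIso_of_le hx, bendIso_of_le hx, bendIso_of_le hx]
  · have h1 : p ≤ bendIso p c' x := by
      have h2 := (bendIso p c').monotone hx
      rwa [bendIso_of_le le_rfl] at h2
    rw [bendIso_of_ge h1, bendIso_of_ge hx, bendIso_of_ge hx, Positive.val_mul]
    ring

end bend

/-! ### Interpolation between points of `A` -/

/-- The slope group contains `l > 1` such that `l - 1` acts invertibly on `A`. -/
structure HasUnitSlope (D : SlopeData) where
  l : PosReal
  mem : l ∈ D.Λ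
  one_lt : (1 : ℝ) < l
  div_mem : ∀ a ∈ D.A, a / ((l : ℝ) - 1) ∈ D.A

section interpolation

variable {D : SlopeData} (U : HasUnitSlope D)

theorem PosReal.coe_zpow (c : PosReal) (n : ℤ) : ((c ^ n : PosReal) : ℝ) = (c : ℝ) ^ n := by
  cases n <;> simp [zpow_natCast, zpow_negSucc]

include U

/-- Two bends suffice. The first, at `a` with slope a power of `l`, brings `b` to `b₁` with `b₁ ≤ b'
< a + l (b₁ - a)`. The second, with slope `l` at some `p` in `[a, b₁]`, makes up the difference. -/
theorem exists_fixing_left {a b b' : ℝ} (ha : a ∈ D.A) (hb : b ∈ D.A) (hb' : b' ∈ D.A)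
    (hab : a < b) (hab' : a < b') : ∃ g ∈ plGroup D, (∀ x ≤ a, g x = x) ∧ g b = b' := by
  obtain ⟨n, hn1, hn2⟩ := exists_mem_Ico_zpow (div_pos (sub_pos.2 hab') (sub_pos.2 hab)) U.one_lt
  rw [le_div_iff₀ (sub_pos.2 hab)] at hn1
  rw [div_lt_iff₀ (sub_pos.2 hab)] at hn2
  have hl0 : (0 : ℝ) < U.l := U.l.2
  have hl1 : 0 < (U.l : ℝ) - 1 := sub_pos.2 U.one_lt
  rw [zpow_add_one₀ hl0.ne'] at hn2
  have hlen : 0 < (U.l : ℝ) ^ n * (b - a) := mul_pos (zpow_pos hl0 n) (sub_pos.2 hab)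
  set b₁ : ℝ := bendIso a (U.l ^ n) b with hb₁
  have hmem : bendIso a (U.l ^ n) ∈ plGroup D := bendIso_mem (D.Λ.zpow_mem U.mem n) ha
  have hb₁A : b₁ ∈ D.A := (IsPL.apply_mem_iff hmem).2 hb
  have hb₁' : b₁ = a + (U.l : ℝ) ^ n * (b - a) := by
    rw [hb₁, bendIso_of_ge hab.le, PosReal.coe_zpow]; ring
  -- A bend of slope `l` at `p` moves `b₁` by `(l - 1)(b₁ - p)`. Solving for `p` divides by `l - 1`,
  -- hence the need for `div_mem`.
  set p : ℝ := b₁ - (b' - b₁) / ((U.l : ℝ) - 1) with hp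
  have hpA : p ∈ D.A := D.A.sub_mem hb₁A (U.div_mem _ (D.A.sub_mem hb' hb₁A))
  have hap : a ≤ p := by
    rw [hp, le_sub_comm, div_le_iff₀ hl1, hb₁']
    nlinarith
  have hpb : p ≤ b₁ := by
    rw [hp, sub_le_self_iff]
    exact div_nonneg (by linarith) hl1.le
  refine ⟨bendIso p U.l * bendIso a (U.l ^ n), (plGroup D).mul_mem (bendIso_mem U.mem hpA) hmem,
    fun x hx => ?_, ?_⟩
  · rw [RelIso.mul_apply, bendIso_of_le hx, bendIso_of_le (hx.trans hap)]
  · rw [RelIso.mul_apply, ← hb₁, bendIso_of_ge hpb]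
    have : ((U.l : ℝ) - 1) * (b₁ - p) = b' - b₁ := by
      rw [hp]; field_simp; ring
    linarith

/-- Two points are sent to two given points in the same order. -/
theorem exists_interpolating {a b a' b' : ℝ} (ha : a ∈ D.A) (hb : b ∈ D.A) (ha' : a' ∈ D.A)
    (hb' : b' ∈ D.A) (hab : a < b) (hab' : a' < b') :
    ∃ g ∈ plGroup D, g a = a' ∧ g b = b' := by
  obtain ⟨g, hg, hg1, hg2⟩ := exists_fixing_left U ha hb (D.A.add_mem (D.A.sub_mem hb' ha') ha) hab
    (by linarith : a < b' - a' + a)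
  refine ⟨affineIso 1 (a' - a) * g, (plGroup D).mul_mem
    (affineIso_mem D.Λ.one_mem (D.A.sub_mem ha' ha)) hg, ?_, ?_⟩
  · rw [RelIso.mul_apply, hg1 a le_rfl]; simp
  · rw [RelIso.mul_apply, hg2]; simp

/-- The restriction of `s` to `[a, b]` extends to a homeomorphism supported in `[u, v]`. -/
theorem exists_cutoff {s : ℝ ≃o ℝ} (hs : s ∈ plGroup D) {u a b v : ℝ} (hu : u ∈ D.A)
    (ha : a ∈ D.A) (hb : b ∈ D.A) (hv : v ∈ D.A) (hua : u < a) (hab : a ≤ b) (hbv : b < v)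
    (hus : u < s a) (hsv : s b < v) :
    ∃ k ∈ plGroup D, (∀ x, x ≤ u ∨ v ≤ x → k x = x) ∧ ∀ x, a ≤ x → x ≤ b → k x = s x := by
  obtain ⟨g₁, hg₁, hg₁u, hg₁a⟩ := exists_interpolating U hu ha hu
    ((IsPL.apply_mem_iff hs).2 ha) hua hus
  obtain ⟨g₂, hg₂, hg₂b, hg₂v⟩ := exists_interpolating U hb hv ((IsPL.apply_mem_iff hs).2 hb)
    hv hbv hsv
  -- Five pieces: the identity, `g₁` on `[u, a]`, `s` on `[a, b]`, `g₂` on `[b, v]`, the identity.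
  let k₁ := glueIso 1 g₁ u (by rw [hg₁u]; rfl)
  have hk₁a : k₁ a = s a := by rw [← hg₁a]; exact glueIso_of_ge hua.le
  let k₂ := glueIso k₁ s a hk₁a
  have hk₂b : k₂ b = g₂ b := by rw [hg₂b]; exact glueIso_of_ge hab
  let k₃ := glueIso k₂ g₂ b hk₂b
  have hk₃v : k₃ v = (1 : ℝ ≃o ℝ) v := by
    change k₃ v = v
    exact (glueIso_of_ge hbv.le).trans hg₂v
  have hk : glueIso k₃ 1 v hk₃v ∈ plGroup D :=
    glueIso_mem (glueIso_mem (glueIso_mem (glueIso_mem (plGroup D).one_mem hg₁ hu) hs ha) hg₂ hb)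
      (plGroup D).one_mem hv
  refine ⟨_, hk, ?_, ?_⟩
  · rintro x (hx | hx)
    · rw [glueIso_of_le (by linarith)]
      exact (glueIso_of_le (by linarith)).trans ((glueIso_of_le (by linarith)).trans
        (glueIso_of_le hx))
    · exact glueIso_of_ge hx
  · intro x hxa hxb
    rw [glueIso_of_le (by linarith)]
    exact (glueIso_of_le hxb).trans (glueIso_of_ge hxa)

/-- The set `A` is dense. -/
theorem exists_mem_between {x y : ℝ} (hxy : x < y) : ∃ a ∈ D.A, x < a ∧ a < y := by
  obtain ⟨n, hn⟩ := exists_pow_lt_of_lt_one (sub_pos.2 hxy)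
    (inv_lt_one_of_one_lt₀ U.one_lt)
  set e : ℝ := ((U.l : ℝ)⁻¹) ^ n with he
  have hl0 : (0 : ℝ) < U.l := U.l.2
  have he0 : 0 < e := pow_pos (inv_pos.2 hl0) n
  have heA : e ∈ D.A := by
    have := D.smul_mem _ (D.Λ.pow_mem (D.Λ.inv_mem U.mem) n) 1 D.one_mem
    simpa [he] using this
  refine ⟨(⌊x / e⌋ + 1) * e, ?_, ?_, ?_⟩
  · have := D.A.zsmul_mem heA (⌊x / e⌋ + 1)
    simpa using this
  · rw [← div_lt_iff₀ he0]
    exact Int.lt_floor_add_one _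
  · have := Int.floor_le (x / e)
    rw [le_div_iff₀ he0] at this
    linarith

end interpolation

/-! ### Breaks -/

/-- Every point has a punctured neighbourhood in which `f` is locally affine. -/
theorem IsPL.eventually_affineGerm {D : SlopeData} {f : ℝ ≃o ℝ} (hf : IsPL D f) (x : ℝ) :
    ∀ᶠ y in 𝓝[≠] x, AffineGerm D (𝓝 y) f := by
  rw [← nhdsLT_sup_nhdsGT, eventually_sup]
  constructor
  · obtain ⟨c, hc, b, hb, h⟩ := (hf x).2.1
    have h1 := h.filter_mono (nhdsWithin_mono x Iio_subset_Iic_self)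
    filter_upwards [eventually_eventually_nhdsWithin.2 h1, self_mem_nhdsWithin] with y hy hyx
    exact ⟨c, hc, b, hb, by rwa [nhdsWithin_eq_nhds.2 (Iio_mem_nhds hyx)] at hy⟩
  · obtain ⟨c, hc, b, hb, h⟩ := (hf x).1
    have h1 := h.filter_mono (nhdsWithin_mono x Ioi_subset_Ici_self)
    filter_upwards [eventually_eventually_nhdsWithin.2 h1, self_mem_nhdsWithin] with y hy hyx
    exact ⟨c, hc, b, hb, by rwa [nhdsWithin_eq_nhds.2 (Ioi_mem_nhds hyx)] at hy⟩

/-- The breaks of `f`. -/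
def breakSet (D : SlopeData) (f : ℝ ≃o ℝ) : Set ℝ := {x | ¬ AffineGerm D (𝓝 x) f}

theorem IsPL.breakSet_subset {D : SlopeData} {f : ℝ ≃o ℝ} (hf : IsPL D f) :
    breakSet D f ⊆ D.A := fun x hx => by
  by_contra h
  exact hx ((hf x).2.2 h)

/-- Infinitely many breaks in a compact interval would accumulate, but every point has a punctured
neighbourhood free of breaks. -/
theorem IsPL.finite_breakSet {D : SlopeData} {f : ℝ ≃o ℝ} (hf : IsPL D f) (u v : ℝ) :
    (breakSet D f ∩ Icc u v).Finite := by
  by_contra h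
  obtain ⟨x, -, hx⟩ := Set.Infinite.exists_accPt_of_subset_isCompact h isCompact_Icc
    inter_subset_right
  rw [accPt_iff_frequently_nhdsNE] at hx
  exact hx ((hf.eventually_affineGerm x).mono fun y hy hy' => hy'.1 hy)

/-- A locally affine map of an interval is affine. -/
theorem exists_affine_of_locally {D : SlopeData} {f : ℝ ≃o ℝ} {s : Set ℝ} (hs : s.OrdConnected)
    (hne : s.Nonempty) (h : ∀ x ∈ s, AffineGerm D (𝓝 x) f) :
    ∃ c ∈ D.Λ, ∃ b ∈ D.A, ∀ x ∈ s, f x = (c : ℝ) * x + b := by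
  obtain ⟨x₀, hx₀⟩ := hne
  -- Slope and intercept are locally constant on `s`, hence constant by connectedness.
  have key : ∀ x ∈ s, ∀ y ∈ s, deriv f x = deriv f y ∧ f x - deriv f x * x = f y - deriv f y * y := by
    intro x hx y hy
    refine hs.isPreconnected.induction₂ (fun x y => deriv f x = deriv f y ∧
      f x - deriv f x * x = f y - deriv f y * y) ?_ ?_ ?_ hx hy
    · intro x hx
      obtain ⟨c, hc, b, hb, h⟩ := h x hx
      apply Filter.Eventually.filter_mono nhdsWithin_le_nhds
      have hd : ∀ᶠ y in 𝓝 x, deriv f y = c ∧ f y = c * y + b := by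
        filter_upwards [h.eventually_nhds] with y hy
        refine ⟨?_, hy.self_of_nhds⟩
        rw [Filter.EventuallyEq.deriv_eq hy]
        simp
      filter_upwards [hd] with y hy
      rw [hy.1, hy.2, hd.self_of_nhds.1, hd.self_of_nhds.2]
      simp
    · rintro x y z - - - ⟨h1, h2⟩ ⟨h3, h4⟩
      exact ⟨h1.trans h3, h2.trans h4⟩
    · rintro x y - - ⟨h1, h2⟩
      exact ⟨h1.symm, h2.symm⟩
  obtain ⟨c, hc, b, hb, h₀⟩ := h x₀ hx₀
  have hd : deriv f x₀ = c := by
    rw [Filter.EventuallyEq.deriv_eq h₀]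
    simp
  refine ⟨c, hc, b, hb, fun x hx => ?_⟩
  obtain ⟨h1, h2⟩ := key x hx x₀ hx₀
  rw [h1, hd, h₀.self_of_nhds] at h2
  linarith

theorem PL.commute_of_disjoint {f g : ℝ ≃o ℝ} (h : ∀ x, f x = x ∨ g x = x) : f * g = g * f := by
  ext x
  rw [RelIso.mul_apply, RelIso.mul_apply]
  by_cases hf : f x = x
  · by_cases hg : g x = x
    · rw [hg, hf, hg]
    · rw [hf]
      exact (h (g x)).resolve_right fun h' => hg (g.injective h')
  · have hg := (h x).resolve_left hf
    rw [hg]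
    exact ((h (f x)).resolve_left fun h' => hf (f.injective h')).symm

theorem natCast_mem_A (D : SlopeData) (n : ℕ) : (n : ℝ) ∈ D.A := by
  simpa using D.A.nsmul_mem D.one_mem n

theorem exists_nat_bound (x y z : ℝ) : ∃ n : ℕ, |x| < n ∧ |y| < n ∧ |z| < n := by
  obtain ⟨n, hn⟩ := exists_nat_gt (max |x| (max |y| |z|))
  simp only [max_lt_iff] at hn
  exact ⟨n, hn⟩

/-! ### Germs at infinity and bounded support -/

/-- `f` is the identity near `-∞` and `x ↦ c x + a` near `∞`. -/
def HasEnds (D : SlopeData) (f : ℝ ≃o ℝ) (c : PosReal) (a : ℝ) : Prop :=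
  c ∈ D.Λ ∧ a ∈ D.A ∧ (∃ M, ∀ x ≤ M, f x = x) ∧ ∃ M, ∀ x ≥ M, f x = c * x + a

namespace HasEnds

variable {D : SlopeData} {f g : ℝ ≃o ℝ} {c c' : PosReal} {a a' : ℝ}

theorem one : HasEnds D 1 1 0 :=
  ⟨D.Λ.one_mem, D.A.zero_mem, ⟨0, fun _ _ => rfl⟩, 0, fun x _ => by simp⟩

theorem mul (hf : HasEnds D f c a) (hg : HasEnds D g c' a') :
    HasEnds D (f * g) (c * c') (c * a' + a) := by
  obtain ⟨hc, ha, ⟨M, hM⟩, M', hM'⟩ := hf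
  obtain ⟨hc', ha', ⟨N, hN⟩, N', hN'⟩ := hg
  refine ⟨D.Λ.mul_mem hc hc', D.A.add_mem (D.smul_mem _ hc _ ha') ha, ⟨min M N, fun x hx => ?_⟩,
    max N' (g.symm M'), fun x hx => ?_⟩
  · rw [RelIso.mul_apply, hN x (hx.trans (min_le_right _ _)), hM x (hx.trans (min_le_left _ _))]
  · rw [RelIso.mul_apply, hM' (g x) ((g.symm_apply_le).1 ((le_max_right _ _).trans hx)),
      hN' x ((le_max_left _ _).trans hx), Positive.val_mul]
    ring

theorem inv (hf : HasEnds D f c a) : HasEnds D f⁻¹ c⁻¹ (-(((c⁻¹ : PosReal) : ℝ) * a)) := by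
  obtain ⟨hc, ha, ⟨M, hM⟩, M', hM'⟩ := hf
  refine ⟨D.Λ.inv_mem hc, D.A.neg_mem (D.smul_mem _ (D.Λ.inv_mem hc) _ ha), ⟨M, fun x hx => ?_⟩,
    f M', fun x hx => ?_⟩
  · exact (f.symm_apply_eq).2 (hM x hx).symm
  · have h1 := hM' (f.symm x) ((f.le_symm_apply).2 hx)
    rw [OrderIso.apply_symm_apply] at h1
    have := c.2.ne'
    change f.symm x = _
    rw [Positive.coe_inv]
    field_simp
    linarith

theorem npow (hf : HasEnds D f 1 a) (n : ℕ) : HasEnds D (f ^ n) 1 (n * a) := by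
  induction n with
  | zero => simpa using HasEnds.one
  | succ n ih =>
    rw [pow_succ]
    convert ih.mul hf using 1
    · simp
    · push_cast; simp; ring

theorem zpow (hf : HasEnds D f 1 a) (n : ℤ) : HasEnds D (f ^ n) 1 (n * a) := by
  cases n with
  | ofNat n => simpa using hf.npow n
  | negSucc n =>
    rw [zpow_negSucc]
    convert (hf.npow (n + 1)).inv using 1
    · simp
    · simp; ring

theorem inv_mul (hf : HasEnds D f c a) (hg : HasEnds D g c a) : HasEnds D (f⁻¹ * g) 1 0 := by
  convert hf.inv.mul hg using 1
  · simp
  · simp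

theorem conj (hf : HasEnds D f 1 0) (g : ℝ ≃o ℝ) : HasEnds D (g * f * g⁻¹) 1 0 := by
  obtain ⟨hc, ha, ⟨M, hM⟩, M', hM'⟩ := hf
  refine ⟨hc, ha, ⟨g M, fun x hx => ?_⟩, g M', fun x hx => ?_⟩
  · change g (f (g.symm x)) = x
    rw [hM _ ((g.symm_apply_le).2 hx), g.apply_symm_apply]
  · change g (f (g.symm x)) = _
    rw [hM' _ ((g.le_symm_apply).2 hx)]
    simp

theorem exists_nat (hf : HasEnds D f 1 0) :
    ∃ n : ℕ, ∀ x, x ≤ -(n : ℝ) ∨ (n : ℝ) ≤ x → f x = x := by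
  obtain ⟨-, -, ⟨M, hM⟩, M', hM'⟩ := hf
  obtain ⟨n, h1, h2, -⟩ := exists_nat_bound M M' 0
  rw [abs_lt] at h1 h2
  refine ⟨n, fun x hx => ?_⟩
  rcases hx with hx | hx
  · exact hM x (by linarith)
  · rw [hM' x (by linarith)]; simp

end HasEnds

theorem hasEnds_of_supp {D : SlopeData} {f : ℝ ≃o ℝ} {u v : ℝ}
    (h : ∀ x, x ≤ u ∨ v ≤ x → f x = x) : HasEnds D f 1 0 :=
  ⟨D.Λ.one_mem, D.A.zero_mem, ⟨u, fun x hx => h x (Or.inl hx)⟩, v, fun x hx => by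
    rw [h x (Or.inr hx)]; simp⟩

theorem hasEnds_bendIso {D : SlopeData} {p : ℝ} {c : PosReal} (hc : c ∈ D.Λ) (hp : p ∈ D.A) :
    HasEnds D (bendIso p c) c (p - c * p) :=
  ⟨hc, D.A.sub_mem hp (D.smul_mem _ hc _ hp), ⟨p, fun _ => bendIso_of_le⟩, p,
    fun _ => bendIso_of_ge⟩

/-- The elements of bounded support. -/
def boundedGroup (D : SlopeData) : Subgroup (plGroup D) where
  carrier := {f | HasEnds D (f : ℝ ≃o ℝ) 1 0}
  mul_mem' hf hg := by simpa using HasEnds.mul hf hg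
  one_mem' := HasEnds.one
  inv_mem' hf := by simpa using HasEnds.inv hf

instance (D : SlopeData) : (boundedGroup D).Normal :=
  ⟨fun _ hf g => HasEnds.conj hf g⟩

/-- Any two elements of `A` are integral multiples of one element of `A`. -/
def IsLocallyCyclic (D : SlopeData) : Prop :=
  ∀ a ∈ D.A, ∀ b ∈ D.A, ∃ c ∈ D.A, ∃ m n : ℤ, a = m * c ∧ b = n * c

section

variable {D : SlopeData} (U : HasUnitSlope D)

include U

/-- A homeomorphism agrees on any bounded set with one of bounded support. -/
theorem exists_bounded_eqOn (g : plGroup D) (n : ℕ) :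
    ∃ k ∈ boundedGroup D, ∀ x, -(n : ℝ) ≤ x → x ≤ n → (k : ℝ ≃o ℝ) x = (g : ℝ ≃o ℝ) x := by
  obtain ⟨m, h1, h2, h3⟩ := exists_nat_bound n ((g : ℝ ≃o ℝ) (-(n : ℝ))) ((g : ℝ ≃o ℝ) n)
  rw [abs_lt] at h1 h2 h3
  have hn : (0 : ℝ) ≤ n := n.cast_nonneg
  obtain ⟨k, hk, hk1, hk2⟩ := exists_cutoff U g.2 (D.A.neg_mem (natCast_mem_A D m))
    (D.A.neg_mem (natCast_mem_A D n)) (natCast_mem_A D n) (natCast_mem_A D m)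
    (by linarith) (by linarith) (by linarith) (by linarith) (by linarith)
  exact ⟨⟨k, hk⟩, hasEnds_of_supp hk1, hk2⟩

/-- Conjugation by any element agrees on a bounded element with conjugation by some bounded one. -/
theorem exists_bounded_conj_eq (g : plGroup D) {b : plGroup D} (hb : b ∈ boundedGroup D) :
    ∃ k ∈ boundedGroup D, k * b * k⁻¹ = g * b * g⁻¹ := by
  obtain ⟨n, hn⟩ := HasEnds.exists_nat hb
  obtain ⟨k, hk, hkg⟩ := exists_bounded_eqOn U g n
  -- `k` agrees with `g` on an interval containing the support of `b`, so `k⁻¹ g` is the identity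
  -- there.
  have h : (b : ℝ ≃o ℝ) * (k⁻¹ * g : plGroup D) = (k⁻¹ * g : plGroup D) * (b : ℝ ≃o ℝ) := by
    apply PL.commute_of_disjoint
    intro x
    rcases le_total x (-n : ℝ) with h | h
    · exact Or.inl (hn x (Or.inl h))
    rcases le_total (n : ℝ) x with h' | h'
    · exact Or.inl (hn x (Or.inr h'))
    · exact Or.inr (((k : ℝ ≃o ℝ).symm_apply_eq).2 (hkg x h h').symm)
  have h' : b * (k⁻¹ * g) = (k⁻¹ * g) * b := Subtype.ext h
  refine ⟨k, hk, ?_⟩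
  calc k * b * k⁻¹ = k * (b * (k⁻¹ * g)) * g⁻¹ := by group
    _ = g * b * g⁻¹ := by rw [h']; group

/-- There is an element that translates a half-line by `a`. -/
theorem exists_translation {a : ℝ} (ha : a ∈ D.A) :
    ∃ f : plGroup D, HasEnds D f 1 a ∧ ∀ x ≥ 0, (f : ℝ ≃o ℝ) x = x + a := by
  obtain ⟨m, h1, h2, -⟩ := exists_nat_bound a 1 0
  rw [abs_lt] at h1 h2
  have hmA := D.A.neg_mem (natCast_mem_A D m)
  obtain ⟨g, hg, hg1, hg2⟩ := exists_interpolating U hmA D.A.zero_mem hmA ha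
    (by linarith : -(m : ℝ) < 0) (by linarith)
  let k := glueIso 1 g (-m) (by rw [hg1]; rfl)
  have hk0 : k 0 = affineIso 1 a 0 := by
    refine (glueIso_of_ge (by linarith)).trans ?_
    simp [hg2]
  have hk : glueIso k (affineIso 1 a) 0 hk0 ∈ plGroup D :=
    glueIso_mem (glueIso_mem (plGroup D).one_mem hg hmA) (affineIso_mem D.Λ.one_mem ha)
      D.A.zero_mem
  have key : ∀ x ≥ 0, glueIso k (affineIso 1 a) 0 hk0 x = x + a := fun x hx => by
    rw [glueIso_of_ge hx]; simp
  refine ⟨⟨_, hk⟩, ⟨D.Λ.one_mem, ha, ⟨-m, fun x hx => ?_⟩, 0, fun x hx => ?_⟩, key⟩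
  · have hx0 : x ≤ 0 := by linarith
    exact (glueIso_of_le (h := hk0) hx0).trans (glueIso_of_le hx)
  · rw [key x hx]; simp

end

/-! ### Homomorphisms for which bounded elements have central image -/

/-- The element of `plGroup D` given by `bendIso`. -/
noncomputable def bend {D : SlopeData} (p : D.A) (c : D.Λ) : plGroup D :=
  ⟨bendIso p c, bendIso_mem c.2 p.2⟩

section central

variable {D : SlopeData} (U : HasUnitSlope D) {Q : Type*} [Group Q] (π : plGroup D →* Q)

open Classical in
/-- The image under `π` of a canonical lift of the translation by `a`. -/
noncomputable def liftTranslation (a : ℝ) : Q :=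
  -- The commutator of scaling by `l` with translation by `a / (l - 1)` is translation by `l a / (l
  -- - 1) - a / (l - 1) = a` near `+∞`.
  if h : ∃ f : plGroup D, HasEnds D f 1 (a / ((U.l : ℝ) - 1)) then
    ⁅π (bend 0 ⟨U.l, U.mem⟩), π h.choose⁆ else 1

variable {π} (hπ : ∀ b ∈ boundedGroup D, ∀ g, Commute (π g) (π b))

include hπ

/-- `f` and `f'` differ by a bounded factor, whose image is central in the image of `π` and so drops
out of the commutator. This makes `liftTranslation` independent of the chosen `f`. -/
theorem commutator_eq_of_hasEnds {f f' : plGroup D} {c : PosReal} {a : ℝ} (hf : HasEnds D f c a)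
    (hf' : HasEnds D f' c a) (q : plGroup D) : ⁅π q, π f⁆ = ⁅π q, π f'⁆ := by
  have hb : f⁻¹ * f' ∈ boundedGroup D := hf.inv_mul hf'
  have h1 := hπ _ hb
  have h2 : π f' = π f * π (f⁻¹ * f') := by simp
  have h3 : Commute (π (f * q⁻¹)) (π (f⁻¹ * f')) := h1 _
  rw [h2, commutatorElement_def, commutatorElement_def]
  have h4 : Commute (π q⁻¹) (π (f⁻¹ * f')) := h1 _
  rw [map_inv] at h4
  calc π q * π f * (π q)⁻¹ * (π f)⁻¹
      = π q * π f * ((π q)⁻¹ * π (f⁻¹ * f')) * (π (f⁻¹ * f'))⁻¹ * (π f)⁻¹ := by group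
    _ = _ := by rw [h4.eq]; group

include U

theorem liftTranslation_eq {a : ℝ} {f : plGroup D} (hf : HasEnds D f 1 (a / ((U.l : ℝ) - 1))) :
    liftTranslation U π a = ⁅π (bend 0 ⟨U.l, U.mem⟩), π f⁆ := by
  have h : ∃ f : plGroup D, HasEnds D f 1 (a / ((U.l : ℝ) - 1)) := ⟨f, hf⟩
  rw [liftTranslation, dif_pos h]
  exact commutator_eq_of_hasEnds hπ h.choose_spec hf _

theorem exists_liftTranslation_eq {a : ℝ} (ha : a ∈ D.A) :
    ∃ f : plGroup D, HasEnds D f 1 a ∧ liftTranslation U π a = π f := by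
  obtain ⟨f, hf, -⟩ := exists_translation U (U.div_mem a ha)
  refine ⟨⁅bend 0 ⟨U.l, U.mem⟩, f⁆, ?_, ?_⟩
  · have h := hasEnds_bendIso (D := D) U.mem D.A.zero_mem
    have h1 := ((h.mul hf).mul h.inv).mul hf.inv
    have hl1 : (U.l : ℝ) - 1 ≠ 0 := (sub_pos.2 U.one_lt).ne'
    have hl0 : (U.l : ℝ) ≠ 0 := U.l.2.ne'
    convert h1 using 1
    · rfl
    · simp
    · simp
      field_simp
      ring
  · rw [liftTranslation_eq U hπ hf, map_commutatorElement]

/-- By local cyclicity both maps are, up to bounded factors, powers of one map `y` that translates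
near `+∞`. -/
theorem commute_of_hasEnds (hA : IsLocallyCyclic D) {f f' : plGroup D} {a a' : ℝ}
    (hf : HasEnds D f 1 a) (hf' : HasEnds D f' 1 a') : Commute (π f) (π f') := by
  obtain ⟨c, hc, m, n, rfl, rfl⟩ := hA a hf.2.1 a' hf'.2.1
  obtain ⟨y, hy, -⟩ := exists_translation U hc
  have h1 : (y ^ m)⁻¹ * f ∈ boundedGroup D := HasEnds.inv_mul (by simpa using hy.zpow m) hf
  have h2 : (y ^ n)⁻¹ * f' ∈ boundedGroup D := HasEnds.inv_mul (by simpa using hy.zpow n) hf'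
  have e1 : π f = π y ^ m * π ((y ^ m)⁻¹ * f) := by simp
  have e2 : π f' = π y ^ n * π ((y ^ n)⁻¹ * f') := by simp
  rw [e1, e2]
  refine Commute.mul_right (Commute.mul_left ?_ ?_) ?_
  · exact (Commute.refl _).zpow_zpow m n
  · rw [← map_zpow]; exact (hπ _ h1 _).symm
  · exact Commute.mul_left (by rw [← map_zpow]; exact hπ _ h2 _) (hπ _ h2 _)

/-- In `[s, xy] = [s, x] · x [s, y] x⁻¹` the last conjugation is trivial on images, because lifts of
translations commute. -/
theorem liftTranslation_add (hA : IsLocallyCyclic D) {a b : ℝ} (ha : a ∈ D.A) (hb : b ∈ D.A) :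
    liftTranslation U π (a + b) = liftTranslation U π a * liftTranslation U π b := by
  obtain ⟨x, hx, -⟩ := exists_translation U (U.div_mem a ha)
  obtain ⟨y, hy, -⟩ := exists_translation U (U.div_mem b hb)
  have hxy : HasEnds D (x * y : plGroup D) 1 ((a + b) / ((U.l : ℝ) - 1)) := by
    convert hx.mul hy using 1
    · rfl
    · simp
    · simp; ring
  obtain ⟨z, hz, hbz⟩ := exists_liftTranslation_eq U hπ hb
  have hcomm : Commute (π x) ⁅π (bend 0 ⟨U.l, U.mem⟩), π y⁆ := by
    rw [← liftTranslation_eq U hπ hy, hbz]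
    exact commute_of_hasEnds U hπ hA hx hz
  rw [liftTranslation_eq U hπ hx, liftTranslation_eq U hπ hy, liftTranslation_eq U hπ hxy, map_mul]
  generalize π (bend 0 ⟨U.l, U.mem⟩) = s at *
  calc ⁅s, π x * π y⁆ = ⁅s, π x⁆ * (π x * ⁅s, π y⁆) * (π x)⁻¹ := by
        simp only [commutatorElement_def]; group
    _ = _ := by rw [hcomm.eq]; group

theorem liftTranslation_zero (hA : IsLocallyCyclic D) : liftTranslation U π 0 = 1 := by
  have := liftTranslation_add U hπ hA D.A.zero_mem D.A.zero_mem
  simpa using this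

/-- Bends at `0` commute. Conjugating the defining commutator by one of slope `c` keeps its first
entry and multiplies the translation length of the second by `c`. -/
theorem conj_liftTranslation {a : ℝ} (ha : a ∈ D.A) (c : D.Λ) :
    π (bend 0 c) * liftTranslation U π a * (π (bend 0 c))⁻¹ = liftTranslation U π ((c : PosReal) * a) := by
  obtain ⟨x, hx, -⟩ := exists_translation U (U.div_mem a ha)
  have h := hasEnds_bendIso (D := D) c.2 D.A.zero_mem
  have hx' : HasEnds D (bend 0 c * x * (bend 0 c)⁻¹ : plGroup D) 1
      ((c : PosReal) * a / ((U.l : ℝ) - 1)) := by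
    convert (h.mul hx).mul h.inv using 1
    · rfl
    · simp
    · simp; ring
  have hs : bend 0 c * bend 0 ⟨U.l, U.mem⟩ * (bend 0 c)⁻¹ = bend (D := D) 0 ⟨U.l, U.mem⟩ := by
    rw [mul_inv_eq_iff_eq_mul]
    apply Subtype.ext
    change bendIso 0 c * bendIso 0 U.l = bendIso 0 U.l * bendIso 0 c
    rw [bendIso_mul, bendIso_mul, mul_comm]
  rw [liftTranslation_eq U hπ hx, liftTranslation_eq U hπ hx', ← map_commutatorElement,
    ← map_commutatorElement, ← map_inv, ← map_mul, ← map_mul]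
  congr 1
  conv_rhs => rw [← hs]
  simp only [commutatorElement_def]
  group

/-- Write `T` for `liftTranslation` and `S` for the image of `bend 0 c`. The bend at `p` is the
conjugate of the bend at `0` by a map translating `[0, ∞)` by `p`, whose image is `T p` up to a
central factor. So the image is `T p · S · (T p)⁻¹ = T p · T (c p)⁻¹ · S`. -/
theorem map_bend (hA : IsLocallyCyclic D) (p : D.A) (c : D.Λ) :
    π (bend p c) = liftTranslation U π (p - (c : PosReal) * p) * π (bend 0 c) := by
  obtain ⟨x, hx, hx0⟩ := exists_translation U p.2
  have hcp : ((c : PosReal) : ℝ) * p ∈ D.A := D.smul_mem _ c.2 _ p.2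
  have hconj : bend p c = x * bend 0 c * x⁻¹ := by
    rw [eq_mul_inv_iff_mul_eq]
    ext y
    change bendIso p c ((x : ℝ ≃o ℝ) y) = (x : ℝ ≃o ℝ) (bendIso 0 c y)
    have hxp : (x : ℝ ≃o ℝ) 0 = p := by rw [hx0 0 le_rfl, zero_add]
    rcases le_total y 0 with hy | hy
    · have := (x : ℝ ≃o ℝ).monotone hy
      rw [hxp] at this
      rw [bendIso_of_le hy, bendIso_of_le this]
    · have := (x : ℝ ≃o ℝ).monotone hy
      rw [hxp] at this
      have hc0 := c.1.2
      rw [bendIso_of_ge hy, bendIso_of_ge this, hx0 y hy, hx0]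
      · ring
      · simp only [mul_zero, sub_zero, add_zero, ge_iff_le]
        positivity
  obtain ⟨z, hz, hpz⟩ := exists_liftTranslation_eq U hπ p.2
  have hzx : z⁻¹ * x ∈ boundedGroup D := hz.inv_mul hx
  have e : π x = π z * π (z⁻¹ * x) := by simp
  have h1 : Commute (π (bend 0 c)) (π (z⁻¹ * x)) := hπ _ hzx _
  have h2 : liftTranslation U π (p - (c : PosReal) * p) * liftTranslation U π ((c : PosReal) * p)
      = liftTranslation U π p := by
    rw [← liftTranslation_add U hπ hA (D.A.sub_mem p.2 hcp) hcp, sub_add_cancel]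
  have h3 := conj_liftTranslation U hπ p.2 c
  rw [← eq_mul_inv_iff_mul_eq, ← h3] at h2
  rw [h2, hpz, hconj, map_mul, map_mul, map_inv, e]
  calc _ = π z * (π (z⁻¹ * x) * π (bend 0 c)) * (π (z⁻¹ * x))⁻¹ * (π z)⁻¹ := by group
    _ = π z * π (bend 0 c) * (π z)⁻¹ := by rw [← h1.eq]; group
    _ = _ := by group

end central

/-! ### Splitting off breaks, and perfectness -/

theorem affine_unique {c d : PosReal} {b e M : ℝ}
    (h : ∀ x > M, (c : ℝ) * x + b = (d : ℝ) * x + e) : c = d ∧ b = e := by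
  have h1 := h (M + 1) (by linarith)
  have h2 := h (M + 2) (by linarith)
  have h3 : (c : ℝ) = d := by linarith
  exact ⟨Subtype.ext h3, by rw [h3] at h1; linarith⟩

theorem HasEnds.finite_breakSet {D : SlopeData} {f : ℝ ≃o ℝ} (hf : f ∈ plGroup D) {c : PosReal}
    {a : ℝ} (h : HasEnds D f c a) : (breakSet D f).Finite := by
  obtain ⟨hc, ha, ⟨M, hM⟩, M', hM'⟩ := h
  refine (IsPL.finite_breakSet hf M M').subset fun x hx => ⟨hx, ?_, ?_⟩
  · by_contra hlt
    refine hx (AffineGerm.id.congr ?_)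
    filter_upwards [eventually_lt_nhds (not_le.1 hlt)] with y hy
    exact (hM y hy.le).symm
  · by_contra hlt
    refine hx ⟨c, hc, a, ha, ?_⟩
    filter_upwards [eventually_gt_nhds (not_le.1 hlt)] with y hy
    exact hM' y hy.le

/-- A map with a last break at `p` agrees on `[p, ∞)` with its affine end. -/
theorem HasEnds.eq_of_no_break {D : SlopeData} {f : ℝ ≃o ℝ} {c : PosReal} {a p : ℝ}
    (h : HasEnds D f c a) (hp : ∀ x > p, x ∉ breakSet D f) : ∀ x ≥ p, f x = c * x + a := by
  obtain ⟨c', hc', b', hb', h1⟩ := exists_affine_of_locally (D := D) (f := f) (s := Ioi p)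
    ordConnected_Ioi ⟨p + 1, by simp⟩ (fun x hx => not_not.1 (hp x hx))
  obtain ⟨hc, ha, -, M', hM'⟩ := h
  obtain ⟨rfl, rfl⟩ := affine_unique (c := c') (b := b') (d := c) (e := a) (M := max p M') fun x hx => by
    rw [← h1 x (lt_of_le_of_lt (le_max_left _ _) hx), hM' x (le_trans (le_max_right _ _) hx.le)]
  have hclosed : IsClosed {x | f x = (c' : ℝ) * x + b'} :=
    isClosed_eq f.continuous (by fun_prop)
  have := hclosed.closure_subset_iff.2 h1
  rw [closure_Ioi] at this
  exact this

theorem exists_max_break {D : SlopeData} {f : ℝ ≃o ℝ} (hf : (breakSet D f).Finite)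
    (hne : (breakSet D f).Nonempty) : ∃ p ∈ breakSet D f, ∀ x > p, x ∉ breakSet D f := by
  obtain ⟨p, hp, hmax⟩ := Set.exists_max_image _ id hf hne
  exact ⟨p, hp, fun x hx hx' => absurd (hmax x hx') (not_le.2 hx)⟩

/-- The last break can be split off. -/
theorem HasEnds.exists_split {D : SlopeData} {f : ℝ ≃o ℝ} (hf : f ∈ plGroup D) {c : PosReal}
    {a p : ℝ} (h : HasEnds D f c a) (hpf : p ∈ breakSet D f)
    (hp : ∀ x > p, x ∉ breakSet D f) :
    ∃ f' ∈ plGroup D, ∃ c' ∈ D.Λ, ∃ a', HasEnds D f' c' a' ∧ f = f' * bendIso p (c'⁻¹ * c) ∧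
      breakSet D f' ⊂ breakSet D f ∧ c' * p + a' = c * p + a := by
  have hr := h.eq_of_no_break hp
  have hpA := IsPL.breakSet_subset hf hpf
  obtain ⟨c', hc', a', ha', hl⟩ := (hf p).2.1
  have hlp : f p = c' * p + a' := hl.self_of_nhdsWithin self_mem_Iic
  have hg : f p = affineIso c' a' p := hlp
  obtain ⟨hc, ha, ⟨M, hM⟩, M', hM'⟩ := h
  have hc0 : (c' : ℝ) ≠ 0 := c'.2.ne'
  have hloc : ∀ x ≥ p, ∀ᶠ y in 𝓝 x, glueIso f (affineIso c' a') p hg y = c' * y + a' := by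
    intro x hx
    rcases hx.lt_or_eq with hx | rfl
    · filter_upwards [eventually_gt_nhds hx] with y hy
      exact glueIso_of_ge hy.le
    · rw [← nhdsLE_sup_nhdsGE, eventually_sup]
      constructor
      · filter_upwards [hl, self_mem_nhdsWithin] with y hy hyp
        rw [glueIso_of_le hyp, hy]
      · filter_upwards [self_mem_nhdsWithin] with y hyp
        exact glueIso_of_ge hyp
  -- `f'` continues the left affine germ of `f` at `p` beyond `p`. This removes the break there, and
  -- bending at `p` beforehand by `c'⁻¹ c` restores the slope `c`.
  refine ⟨glueIso f (affineIso c' a') p hg, glueIso_mem hf (affineIso_mem hc' ha') hpA, c', hc',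
    a', ⟨hc', ha', ⟨min M p, fun x hx => ?_⟩, p, fun x hx => glueIso_of_ge hx⟩, ?_, ?_, ?_⟩
  · rw [glueIso_of_le (hx.trans (min_le_right _ _)), hM x (hx.trans (min_le_left _ _))]
  · ext x
    rw [RelIso.mul_apply]
    rcases le_total x p with hx | hx
    · rw [bendIso_of_le hx, glueIso_of_le hx]
    · have h1 := (bendIso p (c'⁻¹ * c)).monotone hx
      rw [bendIso_of_le le_rfl] at h1
      have h2 := hr p le_rfl
      rw [glueIso_of_ge h1, bendIso_of_ge hx, hr x hx, affineIso_apply, Positive.val_mul,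
        Positive.coe_inv]
      field_simp
      linarith
  · refine ⟨fun x hx => ?_, fun hsub => hsub hpf ⟨c', hc', a', ha', hloc p le_rfl⟩⟩
    rcases lt_or_ge x p with hxp | hxp
    · intro h
      refine hx (h.congr ?_)
      filter_upwards [eventually_lt_nhds hxp] with y hy
      rw [glueIso_of_le hy.le]
    · exact absurd ⟨c', hc', a', ha', hloc x hxp⟩ hx
  · rw [← hlp, hr p le_rfl]

theorem HasEnds.eq_one {D : SlopeData} {f : ℝ ≃o ℝ} {c : PosReal} {a : ℝ}
    (h : HasEnds D f c a) (hf : breakSet D f = ∅) : f = 1 ∧ c = 1 ∧ a = 0 := by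
  have h1 : ∀ x, f x = c * x + a := fun x => h.eq_of_no_break (p := x) (by simp [hf]) x le_rfl
  obtain ⟨-, -, ⟨M, hM⟩, -⟩ := h
  have h2 := hM M le_rfl
  have h3 := hM (M - 1) (by linarith)
  rw [h1] at h2 h3
  have hc : (c : ℝ) = 1 := by linarith
  have ha : a = 0 := by rw [hc] at h2; linarith
  refine ⟨?_, Subtype.ext hc, ha⟩
  ext x
  rw [h1, hc, ha]
  simp

section perfect

variable {D : SlopeData} (U : HasUnitSlope D) {Q : Type*} [Group Q] {π : plGroup D →* Q}

include U

/-- Induction on the number of breaks: split off the last one and evaluate it by `map_bend`. The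
right-hand side involves only the germ at `+∞`, so bounded elements must have trivial image. -/
theorem map_eq_of_hasEnds (hπ : ∀ b ∈ boundedGroup D, ∀ g, Commute (π g) (π b))
    (hA : IsLocallyCyclic D) (f : plGroup D) (c : D.Λ) (a : ℝ) (h : HasEnds D f c a) :
    π f = liftTranslation U π a * π (bend 0 c) := by
  induction hn : (breakSet D (f : ℝ ≃o ℝ)).ncard using Nat.strong_induction_on generalizing f c a with
  | _ n ih =>
  have hfin := HasEnds.finite_breakSet f.2 h
  rcases (breakSet D (f : ℝ ≃o ℝ)).eq_empty_or_nonempty with he | hne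
  · obtain ⟨h1, h2, rfl⟩ := h.eq_one he
    have hf : f = 1 := Subtype.ext h1
    have hc : bend (D := D) 0 c = 1 := by
      apply Subtype.ext
      ext x
      change bendIso 0 (c : PosReal) x = x
      rcases le_total x 0 with hx | hx
      · exact bendIso_of_le hx
      · rw [bendIso_of_ge hx, h2]; simp
    rw [hf, hc, liftTranslation_zero U hπ hA]
    simp
  · obtain ⟨p, hp, hmax⟩ := exists_max_break hfin hne
    obtain ⟨f', hf', c', hc', a', h', hff', hsub, hp'⟩ := h.exists_split f.2 hp hmax
    have hpA : p ∈ D.A := IsPL.breakSet_subset f.2 hp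
    have ih' := ih _ (hn ▸ Set.ncard_lt_ncard hsub hfin) ⟨f', hf'⟩ ⟨c', hc'⟩ a' h' rfl
    set m : D.Λ := ⟨c'⁻¹ * c, D.Λ.mul_mem (D.Λ.inv_mem hc') c.2⟩ with hm
    have hfm : f = ⟨f', hf'⟩ * bend ⟨p, hpA⟩ m := Subtype.ext hff'
    have hcm : bend (D := D) 0 ⟨c', hc'⟩ * bend 0 m = bend 0 c := by
      apply Subtype.ext
      change bendIso 0 c' * bendIso 0 (c'⁻¹ * c) = bendIso 0 c
      rw [bendIso_mul, mul_inv_cancel_left]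
    have hmp : p - ((m : PosReal) : ℝ) * p ∈ D.A := D.A.sub_mem hpA (D.smul_mem _ m.2 _ hpA)
    have hc0 : (c' : ℝ) ≠ 0 := c'.2.ne'
    have ha : a = a' + c' * (p - ((m : PosReal) : ℝ) * p) := by
      rw [hm]
      simp only [Positive.val_mul, Positive.coe_inv]
      field_simp
      linarith
    rw [hfm, map_mul, ih', map_bend U hπ hA ⟨p, hpA⟩ m, ← hcm, map_mul, ha,
      liftTranslation_add U hπ hA h'.2.1 (D.smul_mem _ hc' _ hmp)]
    have h3 := conj_liftTranslation U hπ hmp ⟨c', hc'⟩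
    rw [← h3]
    group

theorem map_bounded_eq_one (hπ : ∀ b ∈ boundedGroup D, ∀ g, Commute (π g) (π b))
    (hA : IsLocallyCyclic D) {f : plGroup D} (hf : f ∈ boundedGroup D) : π f = 1 := by
  have h1 := map_eq_of_hasEnds U hπ hA f 1 0 hf
  have h2 := map_eq_of_hasEnds U hπ hA 1 1 0 HasEnds.one
  rw [h1, ← h2, map_one]

/-- The group of homeomorphisms of bounded support is perfect. -/
theorem boundedGroup_perfect (hA : IsLocallyCyclic D) {f : plGroup D} (hf : f ∈ boundedGroup D) :
    f ∈ ⁅boundedGroup D, boundedGroup D⁆ := by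
  rw [← QuotientGroup.eq_one_iff]
  refine map_bounded_eq_one U (π := QuotientGroup.mk' ⁅boundedGroup D, boundedGroup D⁆) ?_ hA hf
  -- Bounded elements are central modulo `[B,B]`: on a bounded `b`, conjugation by `g` agrees with
  -- conjugation by some bounded `k`, so `[g, b] = [k, b]`.
  intro b hb g
  obtain ⟨k, hk, hkg⟩ := exists_bounded_conj_eq U g hb
  have h : ⁅g, b⁆ ∈ ⁅boundedGroup D, boundedGroup D⁆ := by
    have : ⁅g, b⁆ = ⁅k, b⁆ := by rw [commutatorElement_def, commutatorElement_def, hkg]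
    rw [this]
    exact Subgroup.commutator_mem_commutator hk hb
  rw [← commutatorElement_eq_one_iff_commute, ← map_commutatorElement]
  exact (QuotientGroup.eq_one_iff _).2 h

end perfect

/-! ### Reduction to two commutators by displacement -/

/-- The elements supported in `[-n, n]`. -/
def suppGroup (D : SlopeData) (n : ℕ) : Subgroup (plGroup D) where
  carrier := {f | ∀ x, x ≤ -(n : ℝ) ∨ (n : ℝ) ≤ x → (f : ℝ ≃o ℝ) x = x}
  mul_mem' {f g} hf hg x hx := by
    change (f : ℝ ≃o ℝ) ((g : ℝ ≃o ℝ) x) = x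
    rw [hg x hx, hf x hx]
  one_mem' _ _ := rfl
  inv_mem' {f} hf x hx := ((f : ℝ ≃o ℝ).symm_apply_eq).2 (hf x hx).symm

theorem suppGroup_mono (D : SlopeData) : Monotone (suppGroup D) := by
  intro m n hmn f hf x hx
  have : (m : ℝ) ≤ n := by exact_mod_cast hmn
  exact hf x (hx.imp (fun h => by linarith) fun h => by linarith)

/-- A product of commutators involves finitely many bounded elements, so one interval contains all
their supports. -/
theorem exists_mem_commutator_suppGroup {D : SlopeData} {f : plGroup D}
    (hf : f ∈ ⁅boundedGroup D, boundedGroup D⁆) : ∃ n, f ∈ ⁅suppGroup D n, suppGroup D n⁆ := by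
  have hmono : Monotone fun n => ⁅suppGroup D n, suppGroup D n⁆ := fun m n h =>
    Subgroup.commutator_mono (suppGroup_mono D h) (suppGroup_mono D h)
  rw [Subgroup.commutator_def] at hf
  induction hf using Subgroup.closure_induction with
  | mem x hx =>
    obtain ⟨g, hg, h, hh, rfl⟩ := hx
    obtain ⟨m, hm⟩ := HasEnds.exists_nat hg
    obtain ⟨n, hn⟩ := HasEnds.exists_nat hh
    exact ⟨max m n, Subgroup.commutator_mem_commutator
      (suppGroup_mono D (le_max_left m n) hm) (suppGroup_mono D (le_max_right m n) hn)⟩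
  | one => exact ⟨0, Subgroup.one_mem _⟩
  | mul x y _ _ hx hy =>
    obtain ⟨m, hm⟩ := hx
    obtain ⟨n, hn⟩ := hy
    exact ⟨max m n, Subgroup.mul_mem _ (hmono (le_max_left m n) hm) (hmono (le_max_right m n) hn)⟩
  | inv x _ hx =>
    obtain ⟨m, hm⟩ := hx
    exact ⟨m, Subgroup.inv_mem _ hm⟩

/-- The elements that are the identity to the left of `n`. -/
def rightGroup (D : SlopeData) (n : ℕ) : Subgroup (plGroup D) where
  carrier := {f | f ∈ boundedGroup D ∧ ∀ x : ℝ, x ≤ n → (f : ℝ ≃o ℝ) x = x}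
  mul_mem' {f g} hf hg := ⟨mul_mem hf.1 hg.1, fun x hx => by
    change (f : ℝ ≃o ℝ) ((g : ℝ ≃o ℝ) x) = x
    rw [hg.2 x hx, hf.2 x hx]⟩
  one_mem' := ⟨one_mem _, fun _ _ => rfl⟩
  inv_mem' {f} hf := ⟨inv_mem hf.1, fun x hx =>
    ((f : ℝ ≃o ℝ).symm_apply_eq).2 (hf.2 x hx).symm⟩

theorem commute_suppGroup_rightGroup {D : SlopeData} {n : ℕ} {f g : plGroup D}
    (hf : f ∈ suppGroup D n) (hg : g ∈ rightGroup D n) : Commute f g :=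
  Subtype.ext <| PL.commute_of_disjoint fun x =>
    (le_total (n : ℝ) x).imp (fun h => hf x (Or.inr h)) fun h => hg.2 x h

theorem suppGroup_le (D : SlopeData) (n : ℕ) : suppGroup D n ≤ boundedGroup D :=
  fun _ hf => hasEnds_of_supp hf

/-- A product of commutators of elements supported in `[-n, n]` differs by one commutator from one
commutator. -/
theorem exists_commutator_eq_mul {D : SlopeData} (n : ℕ) {f : plGroup D}
    (hf : f ∈ ⁅suppGroup D n, suppGroup D n⁆) (s : plGroup D)
    (hs : ∀ x, (s : ℝ ≃o ℝ) x = x + (2 * n + 1)) :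
    ∃ G ∈ rightGroup D n, ∃ H ∈ rightGroup D n, ∃ P ∈ boundedGroup D, ⁅G, H⁆ = f * ⁅s, P⁆ := by
  -- The shift `s` by `2n + 1` carries `[-n, ∞)` to `[n + 1, ∞)`, past `[-n, n]`.
  have hconj : ∀ g ∈ suppGroup D n, ∀ G ∈ rightGroup D n, s * (g * G) * s⁻¹ ∈ rightGroup D n := by
    intro g hg G hG
    refine ⟨(inferInstance : (boundedGroup D).Normal).conj_mem _
      (mul_mem (suppGroup_le D n hg) hG.1) s, fun x hx => ?_⟩
    have h1 : (s : ℝ ≃o ℝ) (x - (2 * n + 1)) = x := by rw [hs]; ring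
    have h2 : (s : ℝ ≃o ℝ).symm x = x - (2 * n + 1) := by
      rw [OrderIso.symm_apply_eq, h1]
    change (s : ℝ ≃o ℝ) ((g : ℝ ≃o ℝ) ((G : ℝ ≃o ℝ) ((s : ℝ ≃o ℝ).symm x))) = x
    have hn : (0 : ℝ) ≤ n := n.cast_nonneg
    rw [h2, hG.2 _ (by linarith), hg _ (Or.inl (by linarith)), h1]
  have hstep : ∀ f ∈ suppGroup D n, ∀ g ∈ suppGroup D n, ∀ h ∈ suppGroup D n,
      (∃ G ∈ rightGroup D n, ∃ H ∈ rightGroup D n, ∃ P ∈ boundedGroup D, ⁅G, H⁆ = f * ⁅s, P⁆) →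
      ∃ G ∈ rightGroup D n, ∃ H ∈ rightGroup D n, ∃ P ∈ boundedGroup D,
        ⁅G, H⁆ = ⁅g, h⁆ * f * ⁅s, P⁆ := by
    rintro f hf g hg h hh ⟨G, hG, H, hH, P, hP, e⟩
    have hf' : ⁅g, h⁆ * f ∈ suppGroup D n :=
      mul_mem (Subgroup.commutator_le_self _ (Subgroup.commutator_mem_commutator hg hh)) hf
    -- With `φ = [g, h] f`, the new commutator is `s φ [s, P] s⁻¹`, which equals `[s, φ · s P s⁻¹]
    -- φ`. It commutes with `φ` because the supports are disjoint, so it also equals `φ [s, φ · s P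
    -- s⁻¹]`.
    refine ⟨_, hconj g hg G hG, _, hconj h hh H hH, (⁅g, h⁆ * f) * (s * P * s⁻¹),
      mul_mem (suppGroup_le D n hf')
        ((inferInstance : (boundedGroup D).Normal).conj_mem _ hP s), ?_⟩
    have c1 := commute_suppGroup_rightGroup hh hG
    have c2 := commute_suppGroup_rightGroup (inv_mem hg) (inv_mem hH)
    have c3 : Commute (g⁻¹ * h⁻¹) ⁅G, H⁆ := commute_suppGroup_rightGroup
      (mul_mem (inv_mem hg) (inv_mem hh))
      (Subgroup.commutator_le_self _ (Subgroup.commutator_mem_commutator hG hH))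
    have e1 : ⁅g * G, h * H⁆ = ⁅g, h⁆ * ⁅G, H⁆ := by
      calc ⁅g * G, h * H⁆ = g * (G * h) * H * G⁻¹ * (g⁻¹ * H⁻¹) * h⁻¹ := by
            simp only [commutatorElement_def]; group
        _ = g * h * (⁅G, H⁆ * (g⁻¹ * h⁻¹)) := by
            rw [← c1.eq, c2.eq]; simp only [commutatorElement_def]; group
        _ = _ := by rw [← c3.eq]; simp only [commutatorElement_def]; group
    have e2 : ⁅s * (g * G) * s⁻¹, s * (h * H) * s⁻¹⁆ = s * (⁅g, h⁆ * f * ⁅s, P⁆) * s⁻¹ := by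
      rw [← conjugate_commutatorElement, e1, e, mul_assoc ⁅g, h⁆]
    have c4 : Commute (⁅g, h⁆ * f) ⁅s * (g * G) * s⁻¹, s * (h * H) * s⁻¹⁆ :=
      commute_suppGroup_rightGroup hf' (Subgroup.commutator_le_self _
        (Subgroup.commutator_mem_commutator (hconj g hg G hG) (hconj h hh H hH)))
    generalize ⁅g, h⁆ * f = φ at *
    rw [← mul_inv_eq_iff_eq_mul.2 c4.eq, e2]
    simp only [commutatorElement_def]
    group
  have hle : ⁅suppGroup D n, suppGroup D n⁆ ≤ suppGroup D n := Subgroup.commutator_le_self _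
  rw [Subgroup.commutator_def] at hf hle
  induction hf using Subgroup.closure_induction_left with
  | one => exact ⟨1, one_mem _, 1, one_mem _, 1, one_mem _, by simp⟩
  | mul_left x hx y hy ih =>
    obtain ⟨g, hg, h, hh, rfl⟩ := hx
    exact hstep y (hle hy) g hg h hh ih
  | inv_mul_cancel x hx y hy ih =>
    obtain ⟨g, hg, h, hh, rfl⟩ := hx
    rw [commutatorElement_inv]
    exact hstep y (hle hy) h hh g hg ih

/-- The displacement lemma gives `f = [G, H] [P, s]` with `s` an unbounded translation. Replacing
`s` by a bounded `k` with the same conjugation action on `P` keeps everything bounded. -/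
theorem exists_two_commutators {D : SlopeData} (U : HasUnitSlope D) (hA : IsLocallyCyclic D)
    {f : plGroup D} (hf : f ∈ boundedGroup D) :
    ∃ g₁ ∈ boundedGroup D, ∃ h₁ ∈ boundedGroup D, ∃ g₂ ∈ boundedGroup D, ∃ h₂ ∈ boundedGroup D,
      f = ⁅g₁, h₁⁆ * ⁅g₂, h₂⁆ := by
  obtain ⟨n, hn⟩ := exists_mem_commutator_suppGroup (boundedGroup_perfect U hA hf)
  have hmem : ((2 * n + 1 : ℕ) : ℝ) ∈ D.A := natCast_mem_A D _
  obtain ⟨G, hG, H, hH, P, hP, e⟩ := exists_commutator_eq_mul n hn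
    ⟨_, affineIso_mem D.Λ.one_mem hmem⟩ (fun x => by simp)
  obtain ⟨k, hk, hkP⟩ := exists_bounded_conj_eq U ⟨_, affineIso_mem D.Λ.one_mem hmem⟩ hP
  rw [commutatorElement_def _ P, ← hkP, ← commutatorElement_def] at e
  exact ⟨G, hG.1, H, hH.1, P, hP, k, hk, by rw [← commutatorElement_inv k P, e]; group⟩

/-! ### Two commutators inside `(0, 1)` -/

/-- The elements supported in a compact subset of `(0, 1)`. -/
def innerGroup (D : SlopeData) : Subgroup (plGroup D) where
  carrier := {f | ∃ u v : ℝ, 0 < u ∧ u < v ∧ v < 1 ∧ ∀ x, x ≤ u ∨ v ≤ x → (f : ℝ ≃o ℝ) x = x}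
  mul_mem' := by
    rintro f g ⟨u, v, h1, h2, h3, h4⟩ ⟨u', v', h1', h2', h3', h4'⟩
    refine ⟨min u u', max v v', lt_min h1 h1', ?_, max_lt h3 h3', fun x hx => ?_⟩
    · exact (min_le_left _ _).trans_lt (h2.trans_le (le_max_left _ _))
    · change (f : ℝ ≃o ℝ) ((g : ℝ ≃o ℝ) x) = x
      rw [h4' x, h4 x]
      · exact hx.imp (fun h => h.trans (min_le_left _ _)) fun h => (le_max_left _ _).trans h
      · exact hx.imp (fun h => h.trans (min_le_right _ _)) fun h => (le_max_right _ _).trans h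
  one_mem' := ⟨1 / 3, 2 / 3, by norm_num, by norm_num, by norm_num, fun _ _ => rfl⟩
  inv_mem' := by
    rintro f ⟨u, v, h1, h2, h3, h4⟩
    exact ⟨u, v, h1, h2, h3, fun x hx => ((f : ℝ ≃o ℝ).symm_apply_eq).2 (h4 x hx).symm⟩

theorem supp_conj {f w : ℝ ≃o ℝ} {u v : ℝ} (h : ∀ x, x ≤ u ∨ v ≤ x → f x = x) (x : ℝ)
    (hx : x ≤ w u ∨ w v ≤ x) : (w * f * w⁻¹) x = x := by
  change w (f (w.symm x)) = x
  rw [h (w.symm x) (hx.imp (fun h => (w.symm_apply_le).2 h) fun h => (w.le_symm_apply).2 h),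
    w.apply_symm_apply]

theorem exists_mem_innerGroup {D : SlopeData} (U : HasUnitSlope D) {f : plGroup D}
    (hf : f ∈ innerGroup D) : ∃ u ∈ D.A, ∃ v ∈ D.A, 0 < u ∧ u < v ∧ v < 1 ∧
      ∀ x, x ≤ u ∨ v ≤ x → (f : ℝ ≃o ℝ) x = x := by
  obtain ⟨u, v, h1, h2, h3, h4⟩ := hf
  obtain ⟨u', hu', hu1, hu2⟩ := exists_mem_between U h1
  obtain ⟨v', hv', hv1, hv2⟩ := exists_mem_between U h3
  exact ⟨u', hu', v', hv', hu1, by linarith, hv2, fun x hx =>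
    h4 x (hx.imp (fun h => h.trans hu2.le) fun h => hv1.le.trans h)⟩

theorem exists_inner_two_commutators {D : SlopeData} (U : HasUnitSlope D)
    (hA : IsLocallyCyclic D) {f : plGroup D} (hf : f ∈ innerGroup D) :
    ∃ g₁ ∈ innerGroup D, ∃ h₁ ∈ innerGroup D, ∃ g₂ ∈ innerGroup D, ∃ h₂ ∈ innerGroup D,
      f = ⁅g₁, h₁⁆ * ⁅g₂, h₂⁆ := by
  obtain ⟨u, hu, v, hv, h1, h2, h3, hfs⟩ := exists_mem_innerGroup U hf
  obtain ⟨u', hu', hu1, hu2⟩ := exists_mem_between U h1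
  obtain ⟨v', hv', hv1, hv2⟩ := exists_mem_between U h3
  obtain ⟨g₁, hg₁, h₁, hh₁, g₂, hg₂, h₂, hh₂, rfl⟩ :=
    exists_two_commutators U hA (show f ∈ boundedGroup D from hasEnds_of_supp hfs)
  obtain ⟨n₁, e₁⟩ := HasEnds.exists_nat hg₁
  obtain ⟨n₂, e₂⟩ := HasEnds.exists_nat hh₁
  obtain ⟨n₃, e₃⟩ := HasEnds.exists_nat hg₂
  obtain ⟨n₄, e₄⟩ := HasEnds.exists_nat hh₂
  set n : ℕ := n₁ + n₂ + n₃ + n₄ + 1 with hn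
  have hn1 : (1 : ℝ) ≤ n := by exact_mod_cast (show 1 ≤ n by omega)
  obtain ⟨p, hp, hpn, hpu⟩ := exists_interpolating U (D.A.neg_mem (natCast_mem_A D n)) hu hu' hu
    (by linarith) hu2
  obtain ⟨q, hq, hqv, hqn⟩ := exists_interpolating U hv (natCast_mem_A D n) hv hv'
    (by linarith) hv1
  let k := glueIso p 1 u (by rw [hpu]; rfl)
  have hkv : k v = q v := by
    rw [hqv]
    exact glueIso_of_ge h2.le
  -- `w` is the identity on `[u, v]`, which carries the support of the product, and squeezes `[-n,
  -- n]` onto `[u', v']`. Conjugating by it fixes the product and brings every factor inside `(0,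
  -- 1)`.
  let w : plGroup D := ⟨glueIso k q v hkv,
    glueIso_mem (glueIso_mem hp (plGroup D).one_mem hu) hq hv⟩
  have hwn : (w : ℝ ≃o ℝ) (-n) = u' :=
    (glueIso_of_le (h := hkv) (by linarith)).trans ((glueIso_of_le (by linarith)).trans hpn)
  have hwn' : (w : ℝ ≃o ℝ) n = v' := (glueIso_of_ge (h := hkv) (by linarith)).trans hqn
  have hwf : ∀ x, u ≤ x → x ≤ v → (w : ℝ ≃o ℝ) x = x := fun x hx hx' =>
    (glueIso_of_le (h := hkv) hx').trans (glueIso_of_ge hx)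
  have hin : ∀ m ≤ n, ∀ g ∈ suppGroup D m, w * g * w⁻¹ ∈ innerGroup D := by
    intro m hm g hg
    refine ⟨u', v', hu1, by linarith, hv2, fun x hx => ?_⟩
    rw [← hwn, ← hwn'] at hx
    exact supp_conj (w := w) (suppGroup_mono D hm hg) x hx
  have hcomm : Commute w (⁅g₁, h₁⁆ * ⁅g₂, h₂⁆) := Subtype.ext <| PL.commute_of_disjoint fun x => by
    rcases le_total x u with hx | hx
    · exact Or.inr (hfs x (Or.inl hx))
    rcases le_total v x with hx' | hx'
    · exact Or.inr (hfs x (Or.inr hx'))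
    · exact Or.inl (hwf x hx hx')
  refine ⟨w * g₁ * w⁻¹, hin n₁ (by omega) _ e₁, w * h₁ * w⁻¹, hin n₂ (by omega) _ e₂,
    w * g₂ * w⁻¹, hin n₃ (by omega) _ e₃, w * h₂ * w⁻¹, hin n₄ (by omega) _ e₄, ?_⟩
  rw [← conjugate_commutatorElement, ← conjugate_commutatorElement]
  calc _ = w * (⁅g₁, h₁⁆ * ⁅g₂, h₂⁆) * w⁻¹ := by rw [hcomm.eq]; group
    _ = _ := by group

/-! ### From the line to the circle -/

/-- The homeomorphisms of the line that preserve `[0, 1)`. -/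
def unitStab (D : SlopeData) : Subgroup (plGroup D) where
  carrier := {g | (g : ℝ ≃o ℝ) 0 = 0 ∧ (g : ℝ ≃o ℝ) 1 = 1}
  mul_mem' {f g} hf hg := by
    constructor
    · change (f : ℝ ≃o ℝ) ((g : ℝ ≃o ℝ) 0) = 0
      rw [hg.1, hf.1]
    · change (f : ℝ ≃o ℝ) ((g : ℝ ≃o ℝ) 1) = 1
      rw [hg.2, hf.2]
  one_mem' := ⟨rfl, rfl⟩
  inv_mem' {f} hf := ⟨((f : ℝ ≃o ℝ).symm_apply_eq).2 hf.1.symm,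
    ((f : ℝ ≃o ℝ).symm_apply_eq).2 hf.2.symm⟩

theorem innerGroup_le_unitStab (D : SlopeData) : innerGroup D ≤ unitStab D := by
  rintro f ⟨u, v, h1, h2, h3, h4⟩
  exact ⟨h4 0 (Or.inl h1.le), h4 1 (Or.inr h3.le)⟩

theorem mem_Ico_of_unitStab {D : SlopeData} {g : plGroup D} (hg : g ∈ unitStab D) {x : ℝ}
    (hx : x ∈ Ico (0 : ℝ) 1) : (g : ℝ ≃o ℝ) x ∈ Ico (0 : ℝ) 1 := by
  constructor
  · rw [← hg.1]; exact (g : ℝ ≃o ℝ).monotone hx.1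
  · rw [← hg.2]; exact (g : ℝ ≃o ℝ).strictMono hx.2

/-- Restriction to `[0, 1)`. -/
def unitPerm (D : SlopeData) : unitStab D →* Equiv.Perm UnitIco where
  toFun g :=
    { toFun := fun x => ⟨(g : ℝ ≃o ℝ) x, mem_Ico_of_unitStab g.2 x.2⟩
      invFun := fun x => ⟨((g⁻¹ : unitStab D) : ℝ ≃o ℝ) x, mem_Ico_of_unitStab (g⁻¹).2 x.2⟩
      left_inv := fun x => Subtype.ext ((g : ℝ ≃o ℝ).symm_apply_apply x)
      right_inv := fun x => Subtype.ext ((g : ℝ ≃o ℝ).apply_symm_apply x) }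
  map_one' := rfl
  map_mul' _ _ := rfl

/-- A piecewise affine homeomorphism is affine on any interval without breaks in its interior. -/
theorem IsPL.exists_affine {D : SlopeData} {f : ℝ ≃o ℝ} {u v : ℝ} (huv : u < v)
    (h : ∀ x ∈ Ioo u v, x ∉ breakSet D f) :
    ∃ c ∈ D.Λ, ∃ b ∈ D.A, ∀ x ∈ Icc u v, f x = (c : ℝ) * x + b := by
  obtain ⟨c, hc, b, hb, h1⟩ := exists_affine_of_locally (D := D) (f := f) (s := Ioo u v)
    ordConnected_Ioo (nonempty_Ioo.2 huv) (fun x hx => not_not.1 (h x hx))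
  have hclosed : IsClosed {x | f x = (c : ℝ) * x + b} := isClosed_eq f.continuous (by fun_prop)
  have := hclosed.closure_subset_iff.2 h1
  rw [closure_Ioo huv.ne] at this
  exact ⟨c, hc, b, hb, this⟩

theorem isAffineExchange_unitPerm {D : SlopeData} (g : unitStab D) :
    IsAffineExchange D (unitPerm D g) := by
  classical
  have hfin : {x : UnitIco | (x : ℝ) = 0 ∨ (x : ℝ) ∈ breakSet D (g : ℝ ≃o ℝ)}.Finite := by
    have h := ((IsPL.finite_breakSet g.1.2 0 1).insert 0).preimage
      (Subtype.val_injective (p := fun x : ℝ => x ∈ Ico (0 : ℝ) 1)).injOn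
    exact h.subset fun x hx => hx.imp id fun h => ⟨h, x.2.1, x.2.2.le⟩
  have hA : ∀ s ∈ hfin.toFinset, (s : ℝ) ∈ D.A := fun s hs => by
    rcases hfin.mem_toFinset.1 hs with h | h
    · rw [h]; exact D.A.zero_mem
    · exact IsPL.breakSet_subset g.1.2 h
  refine ⟨hfin.toFinset, ⟨⟨0, by simp⟩, hfin.mem_toFinset.2 (Or.inl rfl), rfl⟩, fun s hs =>
    ⟨hA s hs, (IsPL.apply_mem_iff g.1.2).2 (hA s hs)⟩, fun u v hu huv hv hS => ?_⟩
  obtain ⟨c, hc, b, -, h⟩ := IsPL.exists_affine (D := D) (f := (g : ℝ ≃o ℝ)) huv fun x hx hxb =>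
    hS ⟨x, hu.trans hx.1.le, hx.2.trans_le hv⟩ (hfin.mem_toFinset.2 (Or.inr hxb)) hx
  exact ⟨c, hc, b, fun x hux hxv => h x ⟨hux, hxv.le⟩⟩

theorem IsAffineExchange.full {D : SlopeData} {f : Equiv.Perm UnitIco}
    (hf : IsAffineExchange D f) : IsAffineExchange fullSlopeData f := by
  obtain ⟨S, h0, hA, h⟩ := hf
  refine ⟨S, h0, fun s _ => ⟨AddSubgroup.mem_top _, AddSubgroup.mem_top _⟩,
    fun u v hu huv hv hS => ?_⟩
  obtain ⟨c, -, b, hb⟩ := h u v hu huv hv hS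
  exact ⟨c, Subgroup.mem_top _, b, hb⟩

theorem continuous_toCirclePerm_unitPerm {D : SlopeData} (g : unitStab D) :
    Continuous (toCirclePerm (unitPerm D g)) := by
  have h : Continuous (AddCircle.liftIco (1 : ℝ) 0
      (fun x => (((g : ℝ ≃o ℝ) x : ℝ) : UnitAddCircle))) := by
    apply AddCircle.liftIco_zero_continuous
    · rw [g.2.1, g.2.2, AddCircle.coe_period]; simp
    · exact ((AddCircle.continuous_mk' 1).comp (g : ℝ ≃o ℝ).continuous).continuousOn
  exact h

theorem mem_bieriStrebelT {D : SlopeData} {f : Equiv.Perm UnitIco} (h : IsAffineExchange D f)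
    (h1 : Continuous (toCirclePerm f)) (h2 : Continuous (toCirclePerm f⁻¹)) :
    f ∈ bieriStrebelT D := ⟨⟨h.full, h1, h2⟩, h⟩

/-- Homeomorphisms of the line preserving `[0, 1)`, seen as homeomorphisms of the circle. -/
noncomputable def unitHom (D : SlopeData) : unitStab D →* bieriStrebelT D :=
  (unitPerm D).codRestrict _ fun g => mem_bieriStrebelT (isAffineExchange_unitPerm g)
    (continuous_toCirclePerm_unitPerm g) (by
      rw [← map_inv]; exact continuous_toCirclePerm_unitPerm g⁻¹)

theorem unitHom_apply {D : SlopeData} (g : unitStab D) (x : UnitIco) :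
    ((unitHom D g : Equiv.Perm UnitIco) x : ℝ) = (g : ℝ ≃o ℝ) x := rfl

/-! ### Rotations -/

/-- The rotation `x ↦ x + a` of the circle. -/
noncomputable def rotationPerm (a : ℝ) : Equiv.Perm UnitIco :=
  toCirclePerm.symm (Equiv.addRight (a : UnitAddCircle))

theorem rotationPerm_apply (a : ℝ) (x : UnitIco) : (rotationPerm a x : ℝ) = Int.fract (x + a) := by
  have : (rotationPerm a x : ℝ)
      = ((AddCircle.equivIco (1 : ℝ) 0 (((x : ℝ) + a : ℝ) : UnitAddCircle) : Ico (0 : ℝ) (0 + 1)) : ℝ) := rfl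
  rw [this, AddCircle.coe_equivIco_mk_apply]
  simp

theorem isAffineExchange_rotationPerm {D : SlopeData} {a : ℝ} (ha : a ∈ D.A) :
    IsAffineExchange D (rotationPerm a) := by
  classical
  have hint : ∀ n : ℤ, (n : ℝ) ∈ D.A := fun n => by simpa using D.A.zsmul_mem D.one_mem n
  have hfr : ∀ b ∈ D.A, Int.fract b ∈ D.A := fun b hb => D.A.sub_mem hb (hint _)
  refine ⟨{⟨0, by simp⟩, ⟨Int.fract (-a), Int.fract_nonneg _, Int.fract_lt_one _⟩},
    ⟨⟨0, by simp⟩, by simp, rfl⟩, fun s hs => ?_, fun u v hu huv hv hS => ?_⟩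
  · have hsA : (s : ℝ) ∈ D.A := by
      rcases Finset.mem_insert.1 hs with rfl | hs
      · exact D.A.zero_mem
      · rw [Finset.mem_singleton.1 hs]
        exact hfr _ (D.A.neg_mem ha)
    rw [rotationPerm_apply]
    exact ⟨hsA, hfr _ (D.A.add_mem hsA ha)⟩
  · refine ⟨1, D.Λ.one_mem, a - ⌊u + a⌋, fun x hux hxv => ?_⟩
    have hfl : ⌊(x : ℝ) + a⌋ = ⌊u + a⌋ := by
      by_contra hne
      have h1 : ⌊u + a⌋ ≤ ⌊(x : ℝ) + a⌋ := Int.floor_le_floor (by linarith)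
      have h2 : ⌊u + a⌋ + 1 ≤ ⌊(x : ℝ) + a⌋ := by omega
      have h3 : ((⌊u + a⌋ + 1 : ℤ) : ℝ) ≤ (x : ℝ) + a := Int.le_floor.1 h2
      have h4 := Int.lt_floor_add_one (u + a)
      -- If the integer part jumped between `u` and `x`, the jump would occur at the break `fract
      -- (-a)`, which then lies inside `(u, v)`.
      have hy : Int.fract (-a) = ((⌊u + a⌋ + 1 : ℤ) : ℝ) - a := by
        rw [← Int.fract_intCast_add (⌊u + a⌋ + 1), ← sub_eq_add_neg, Int.fract_eq_self]
        push_cast at h3 ⊢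
        exact ⟨by linarith, by linarith⟩
      refine hS ⟨Int.fract (-a), Int.fract_nonneg _, Int.fract_lt_one _⟩ (by simp) ?_
      simp only [hy]
      push_cast at h3 ⊢
      exact ⟨by linarith, by linarith⟩
    rw [rotationPerm_apply, Int.fract, hfl]
    simp
    ring

/-- The rotation by `a ∈ A`, as an element of the Bieri-Strebel group. -/
noncomputable def circleRotation {D : SlopeData} (a : D.A) : bieriStrebelT D :=
  ⟨rotationPerm a, mem_bieriStrebelT (isAffineExchange_rotationPerm a.2)
    (by
      rw [rotationPerm, MulEquiv.apply_symm_apply]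
      exact continuous_id.add continuous_const)
    (by
      rw [rotationPerm, map_inv, MulEquiv.apply_symm_apply]
      exact continuous_id.add continuous_const)⟩

theorem circleRotation_apply {D : SlopeData} (a : D.A) (x : UnitIco) :
    ((circleRotation a : Equiv.Perm UnitIco) x : ℝ) = Int.fract ((x : ℝ) + a) := rotationPerm_apply a x

/-! ### Lifting circle homeomorphisms that fix `0` -/

section lift

variable {D : SlopeData} {f : Equiv.Perm UnitIco}

/-- Every point of `[0, 1)` has a right neighbourhood on which an affine exchange is affine. -/
theorem IsAffineExchange.exists_right (hf : IsAffineExchange D f) (x : UnitIco) :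
    ∃ a b : ℝ, a ∈ D.A ∧ 0 ≤ a ∧ a ≤ x ∧ (x : ℝ) < b ∧ b ≤ 1 ∧ ∃ c ∈ D.Λ, ∃ d ∈ D.A,
      ∀ y : UnitIco, a ≤ y → (y : ℝ) < b → (f y : ℝ) = (c : ℝ) * y + d := by
  obtain ⟨S, h0, hA, haff⟩ := hf
  obtain ⟨a, haS, b, hax, hxb, hb1, hS, -⟩ := exists_piece S h0 x
  obtain ⟨c, hc, d, hcd⟩ := haff a b a.2.1 (hax.trans_lt hxb) hb1 hS
  refine ⟨a, b, (hA a haS).1, a.2.1, hax, hxb, hb1, c, hc, d, ?_, hcd⟩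
  have := hcd a le_rfl (hax.trans_lt hxb)
  rw [show d = f a - c * a by linarith]
  exact D.A.sub_mem (hA a haS).2 (D.smul_mem _ hc _ (hA a haS).1)

/-- The case `x = 1` is included, which supplies the germ at the right end of `[0, 1)`. -/
theorem IsAffineExchange.exists_left (hf : IsAffineExchange D f) {x : ℝ} (hx : 0 < x)
    (hx1 : x ≤ 1) : ∃ a, 0 ≤ a ∧ a < x ∧ ∃ c ∈ D.Λ, ∃ d ∈ D.A,
      ∀ y : UnitIco, a ≤ y → (y : ℝ) < x → (f y : ℝ) = (c : ℝ) * y + d := by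
  classical
  obtain ⟨S, ⟨s, hs, hs0⟩, hA, haff⟩ := hf
  obtain ⟨a, ha, hmax⟩ := Finset.exists_max_image (S.filter fun t : UnitIco => (t : ℝ) < x)
    (fun t => (t : ℝ)) ⟨s, Finset.mem_filter.2 ⟨hs, by rw [hs0]; exact hx⟩⟩
  obtain ⟨haS, hax⟩ := Finset.mem_filter.1 ha
  obtain ⟨c, hc, d, hcd⟩ := haff a x a.2.1 hax hx1 fun t ht h =>
    absurd (hmax t (Finset.mem_filter.2 ⟨ht, h.2⟩)) (not_le.2 h.1)
  refine ⟨a, a.2.1, hax, c, hc, d, ?_, hcd⟩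
  have := hcd a le_rfl hax
  rw [show d = f a - c * a by linarith]
  exact D.A.sub_mem (hA a haS).2 (D.smul_mem _ hc _ (hA a haS).1)

/-- The extension of `f` by the identity. -/
noncomputable def extendPerm (f : Equiv.Perm UnitIco) (x : ℝ) : ℝ :=
  open Classical in if h : x ∈ Ico (0 : ℝ) 1 then f ⟨x, h⟩ else x

theorem extendPerm_coe (f : Equiv.Perm UnitIco) (x : UnitIco) : extendPerm f x = f x := by
  rw [extendPerm, dif_pos x.2]

theorem extendPerm_of_notMem (f : Equiv.Perm UnitIco) {x : ℝ} (hx : x ∉ Ico (0 : ℝ) 1) :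
    extendPerm f x = x := dif_neg hx

/-- The identification of the circle with `[0, 1)` is discontinuous only at the class of `0`. Since
`f` is injective and fixes `0`, interior points avoid it. -/
theorem continuousAt_extendPerm (hf : Continuous (toCirclePerm f))
    (h0 : f ⟨0, by simp⟩ = ⟨0, by simp⟩) {x : ℝ} (hx : x ∈ Ioo (0 : ℝ) 1) :
    ContinuousAt (extendPerm f) x := by
  have hx' : x ∈ Ico (0 : ℝ) 1 := ⟨hx.1.le, hx.2⟩
  have hco : ∀ y : UnitIco, toCirclePerm f ((y : ℝ) : UnitAddCircle) = ((f y : ℝ) : UnitAddCircle) := by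
    intro y
    rw [← circleEquivIco_symm_apply, ← circleEquivIco_symm_apply]
    simp [toCirclePerm, Equiv.permCongrHom]
  have hne : toCirclePerm f (x : UnitAddCircle) ≠ ((0 : ℝ) : UnitAddCircle) := by
    intro h
    have h1 := hco ⟨0, by simp⟩
    rw [h0] at h1
    have h2 := (toCirclePerm f).injective (h.trans h1.symm)
    have h3 : (⟨x, hx'⟩ : UnitIco) = ⟨0, by simp⟩ := circleEquivIco.symm.injective h2
    have := congrArg Subtype.val h3
    simp only at this
    linarith [hx.1]
  have hc' : Continuous (fun y : ℝ => toCirclePerm f (y : UnitAddCircle)) :=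
    hf.comp (AddCircle.continuous_mk' 1)
  have hc : ContinuousAt (fun y : ℝ => ((AddCircle.equivIco (1 : ℝ) 0
      (toCirclePerm f (y : UnitAddCircle)) : Ico (0 : ℝ) (0 + 1)) : ℝ)) x :=
    continuousAt_subtype_val.comp (ContinuousAt.comp (f := fun y : ℝ => toCirclePerm f (y : UnitAddCircle))
      (AddCircle.continuousAt_equivIco 1 0 hne) hc'.continuousAt)
  refine hc.congr ?_
  filter_upwards [Ioo_mem_nhds hx.1 hx.2] with y hy
  have hy' : y ∈ Ico (0 : ℝ) 1 := ⟨hy.1.le, hy.2⟩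
  have h1 := extendPerm_coe f ⟨y, hy'⟩
  simp only at h1
  rw [h1]
  have h2 := hco ⟨y, hy'⟩
  simp only at h2
  rw [h2, ← circleEquivIco_symm_apply]
  exact congrArg Subtype.val (circleEquivIco.apply_symm_apply (f ⟨y, hy'⟩))

/-- Away from `0`, continuity and injectivity leave only an increasing or a decreasing map. The
positive slopes exclude the second. -/
theorem strictMonoOn_extendPerm (hf : IsAffineExchange D f) (hc : Continuous (toCirclePerm f))
    (h0 : f ⟨0, by simp⟩ = ⟨0, by simp⟩) : StrictMonoOn (extendPerm f) (Ico 0 1) := by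
  have hinj : InjOn (extendPerm f) (Ico 0 1) := by
    intro x hx y hy hxy
    rw [extendPerm_coe f ⟨x, hx⟩, extendPerm_coe f ⟨y, hy⟩] at hxy
    exact congrArg Subtype.val (f.injective (Subtype.ext hxy))
  intro u hu v hv huv
  rcases hu.1.eq_or_lt with rfl | hu0
  · have h1 : extendPerm f 0 = 0 := by
      rw [extendPerm_coe f ⟨0, hu⟩, h0]
    have h2 : 0 ≤ extendPerm f v := by
      rw [extendPerm_coe f ⟨v, hv⟩]; exact (f _).2.1
    refine lt_of_le_of_ne (h1.trans_le h2) fun h => huv.ne (hinj hu hv h)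
  have hsub : Icc u v ⊆ Ico 0 1 := fun x hx => ⟨hu.1.trans hx.1, hx.2.trans_lt hv.2⟩
  rcases ContinuousOn.strictMonoOn_of_injOn_Icc' huv.le (fun x hx =>
    (continuousAt_extendPerm hc h0
      ⟨hu0.trans_le hx.1, hx.2.trans_lt hv.2⟩).continuousWithinAt) (hinj.mono hsub) with h | h
  · exact h (left_mem_Icc.2 huv.le) (right_mem_Icc.2 huv.le) huv
  · exfalso
    obtain ⟨a, b, -, -, hau, hub, hb1, c, -, d, -, hcd⟩ := hf.exists_right ⟨u, hu⟩
    obtain ⟨w, hw1, hw2⟩ := exists_between (lt_min hub huv)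
    have hw3 := lt_min_iff.1 hw2
    simp only at hw1 hau
    have hwI : w ∈ Ico (0 : ℝ) 1 := ⟨hu.1.trans hw1.le, hw3.1.trans_le hb1⟩
    have h1 := h (left_mem_Icc.2 huv.le) ⟨hw1.le, hw3.2.le⟩ hw1
    rw [extendPerm_coe f ⟨u, hu⟩, extendPerm_coe f ⟨w, hwI⟩, hcd ⟨u, hu⟩ hau hub,
      hcd ⟨w, hwI⟩ (hau.trans hw1.le) hw3.1] at h1
    have := mul_lt_mul_of_pos_left hw1 c.2
    simp only at h1
    linarith

/-- A homeomorphism of the circle that fixes `0` comes from the line. -/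
theorem exists_unitHom_eq {φ : bieriStrebelT D}
    (h0 : (φ : Equiv.Perm UnitIco) ⟨0, by simp⟩ = ⟨0, by simp⟩) :
    ∃ g : unitStab D, unitHom D g = φ ∧ ∀ x, x ≤ 0 ∨ 1 ≤ x → (g : ℝ ≃o ℝ) x = x := by
  obtain ⟨f, hφ⟩ := φ
  have h0 : f ⟨0, by simp⟩ = ⟨0, by simp⟩ := h0
  have hf : IsAffineExchange D f := hφ.2
  have hc : Continuous (toCirclePerm f) := hφ.1.2.1
  have hmono := strictMonoOn_extendPerm hf hc h0
  have hmem : ∀ x ∈ Ico (0 : ℝ) 1, extendPerm f x ∈ Ico (0 : ℝ) 1 := fun x hx => by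
    rw [extendPerm_coe f ⟨x, hx⟩]; exact (f _).2
  have hlt : ∀ {x}, x < 0 → extendPerm f x = x := fun {x} hx =>
    extendPerm_of_notMem f fun h => absurd h.1 (not_le.2 hx)
  have hge : ∀ {x}, 1 ≤ x → extendPerm f x = x := fun {x} hx =>
    extendPerm_of_notMem f fun h => absurd h.2 (not_lt.2 hx)
  have hz : extendPerm f 0 = 0 := by
    rw [extendPerm_coe f ⟨0, by simp⟩, h0]
  have hsm : StrictMono (extendPerm f) := by
    intro x y hxy
    rcases lt_or_ge x 0 with hx | hx
    · rw [hlt hx]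
      rcases lt_or_ge y 0 with hy | hy
      · rwa [hlt hy]
      rcases lt_or_ge y 1 with hy' | hy'
      · exact hx.trans_le (hmem y ⟨hy, hy'⟩).1
      · rwa [hge hy']
    rcases lt_or_ge x 1 with hx' | hx'
    · rcases lt_or_ge y 1 with hy' | hy'
      · exact hmono ⟨hx, hx'⟩ ⟨hx.trans hxy.le, hy'⟩ hxy
      · rw [hge hy']; exact (hmem x ⟨hx, hx'⟩).2.trans_le hy'
    · rwa [hge hx', hge (hx'.trans hxy.le)]
  have hsurj : Function.Surjective (extendPerm f) := by
    intro y
    by_cases hy : y ∈ Ico (0 : ℝ) 1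
    · refine ⟨f.symm ⟨y, hy⟩, ?_⟩
      rw [extendPerm_coe, Equiv.apply_symm_apply]
    · exact ⟨y, extendPerm_of_notMem f hy⟩
  set g : ℝ ≃o ℝ := StrictMono.orderIsoOfSurjective _ hsm hsurj with hg
  have hgx : ∀ x, g x = extendPerm f x := fun _ => rfl
  have hgle : ∀ x ≤ 0, g x = x := fun x hx => by
    rcases hx.lt_or_eq with h | rfl
    · exact hlt h
    · exact hz
  have hgge : ∀ x ≥ 1, g x = x := fun x hx => hge hx
  have hright : ∀ x ∈ Ico (0 : ℝ) 1, AffineGerm D (𝓝[≥] x) g ∧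
      (x ∉ D.A → AffineGerm D (𝓝 x) g) := by
    intro x hx
    obtain ⟨a, b, haA, ha0, hax, hxb, hb1, c, hc, d, hd, hcd⟩ := hf.exists_right ⟨x, hx⟩
    simp only at hax hxb
    have key : ∀ y, a ≤ y → y < b → g y = c * y + d := fun y hay hyb => by
      rw [hgx, extendPerm_coe f ⟨y, ha0.trans hay, hyb.trans_le hb1⟩]
      exact hcd _ hay hyb
    refine ⟨⟨c, hc, d, hd, ?_⟩, fun hxA => ⟨c, hc, d, hd, ?_⟩⟩
    · filter_upwards [Ico_mem_nhdsGE hxb] with y hy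
      exact key y (hax.trans hy.1) hy.2
    · have : a < x := lt_of_le_of_ne hax fun h => hxA (h ▸ haA)
      filter_upwards [Ioo_mem_nhds this hxb] with y hy
      exact key y hy.1.le hy.2
  have hleft : ∀ x ∈ Ioc (0 : ℝ) 1, AffineGerm D (𝓝[≤] x) g := by
    intro x hx
    obtain ⟨a, ha0, hax, c, hc, d, hd, hcd⟩ := hf.exists_left hx.1 hx.2
    have hclosed : IsClosed {y | g y = (c : ℝ) * y + d} := isClosed_eq g.continuous (by fun_prop)
    have key : Ico a x ⊆ {y | g y = (c : ℝ) * y + d} := fun y hy => by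
      rw [mem_ofPred_eq, hgx, extendPerm_coe f ⟨y, ha0.trans hy.1, hy.2.trans_le hx.2⟩]
      exact hcd _ hy.1 hy.2
    have := hclosed.closure_subset_iff.2 key
    rw [closure_Ico hax.ne] at this
    refine ⟨c, hc, d, hd, ?_⟩
    filter_upwards [Icc_mem_nhdsLE hax] with y hy using this hy
  have hid : ∀ l : Filter ℝ, (∀ᶠ y in l, g y = y) → AffineGerm D l g := fun l h =>
    AffineGerm.id.congr (h.mono fun _ h => h.symm)
  have hlt' : ∀ x < 0, ∀ᶠ y in 𝓝 x, g y = y := fun x hx =>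
    (eventually_lt_nhds hx).mono fun y hy => hgle y hy.le
  have hgt' : ∀ x > 1, ∀ᶠ y in 𝓝 x, g y = y := fun x hx =>
    (eventually_gt_nhds hx).mono fun y hy => hgge y (le_of_lt hy)
  have hPL : g ∈ plGroup D := by
    intro x
    refine ⟨?_, ?_, fun hxA => ?_⟩
    · rcases lt_or_ge x 0 with hx | hx
      · exact hid _ ((hlt' x hx).filter_mono nhdsWithin_le_nhds)
      rcases lt_or_ge x 1 with hx' | hx'
      · exact (hright x ⟨hx, hx'⟩).1
      · exact hid _ (eventually_mem_nhdsWithin.mono fun y hy => hgge y (hx'.trans hy))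
    · rcases lt_or_ge 1 x with hx | hx
      · exact hid _ ((hgt' x hx).filter_mono nhdsWithin_le_nhds)
      rcases lt_or_ge 0 x with hx' | hx'
      · exact hleft x ⟨hx', hx⟩
      · exact hid _ (eventually_mem_nhdsWithin.mono fun y hy => hgle y (le_trans hy hx'))
    · rcases lt_or_ge x 0 with hx | hx
      · exact hid _ (hlt' x hx)
      rcases lt_or_ge x 1 with hx' | hx'
      · exact (hright x ⟨hx, hx'⟩).2 hxA
      · exact hid _ (hgt' x (lt_of_le_of_ne hx' fun h => hxA (h ▸ D.one_mem)))
  refine ⟨⟨⟨g, hPL⟩, hgle 0 le_rfl, hgge 1 le_rfl⟩, ?_, fun x hx => hx.elim (hgle x) (hgge x)⟩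
  apply Subtype.ext
  apply Equiv.ext
  intro x
  exact Subtype.ext (extendPerm_coe f x)

end lift

/-! ### Products of conjugates -/

/-- `φ` is a product of at most `n` conjugates of `f` or `f⁻¹`. -/
def IsConjProduct {G : Type*} [Group G] (f : G) (n : ℕ) (φ : G) : Prop :=
  ∃ l : List G, l.length ≤ n ∧ (∀ x ∈ l, IsConj f x ∨ IsConj f⁻¹ x) ∧ l.prod = φ

namespace IsConjProduct

variable {G : Type*} [Group G] {f φ ψ : G} {m n : ℕ}

theorem mul (h : IsConjProduct f m φ) (h' : IsConjProduct f n ψ) :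
    IsConjProduct f (m + n) (φ * ψ) := by
  obtain ⟨l, hl, hc, rfl⟩ := h
  obtain ⟨l', hl', hc', rfl⟩ := h'
  refine ⟨l ++ l', by rw [List.length_append]; omega, fun x hx => ?_, List.prod_append⟩
  exact (List.mem_append.1 hx).elim (hc x) (hc' x)

theorem conj (h : IsConjProduct f n φ) (g : G) : IsConjProduct f n (g * φ * g⁻¹) := by
  obtain ⟨l, hl, hc, rfl⟩ := h
  refine ⟨l.map (MulAut.conj g), by rwa [List.length_map], fun x hx => ?_, ?_⟩
  · obtain ⟨y, hy, rfl⟩ := List.mem_map.1 hx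
    have hyx : IsConj y (MulAut.conj g y) := isConj_iff.2 ⟨g, rfl⟩
    exact (hc y hy).imp (fun h => h.trans hyx) fun h => h.trans hyx
  · rw [← map_list_prod]; rfl

/-- If `f g⁻¹ f⁻¹` commutes with `h`, then `⁅g, h⁆` is a product of four conjugates of `f`, `f⁻¹`. -/
theorem commutator {g h : G} (hc : Commute (f * g⁻¹ * f⁻¹) h) : IsConjProduct f 4 ⁅g, h⁆ := by
  -- The list spells `[[g, f], h]`. Here `[g, f] = g · (f g⁻¹ f⁻¹)`, and the second factor commutes
  -- with `h`, so the product is `[g, h]`.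
  refine ⟨[g * f * g⁻¹, f⁻¹, h * f * h⁻¹, (h * g) * f⁻¹ * (h * g)⁻¹], le_rfl, ?_, ?_⟩
  · intro x hx
    simp only [List.mem_cons, List.not_mem_nil, or_false] at hx
    rcases hx with rfl | rfl | rfl | rfl
    · exact Or.inl (isConj_iff.2 ⟨g, rfl⟩)
    · exact Or.inr (IsConj.refl _)
    · exact Or.inl (isConj_iff.2 ⟨h, rfl⟩)
    · exact Or.inr (isConj_iff.2 ⟨h * g, rfl⟩)
  · simp only [List.prod_cons, List.prod_nil, mul_one]
    calc _ = g * ((f * g⁻¹ * f⁻¹) * h) * (f * g⁻¹ * f⁻¹)⁻¹ * g⁻¹ * h⁻¹ := by group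
      _ = _ := by rw [hc.eq, commutatorElement_def]; group

end IsConjProduct

/-! ### Displacement on the circle and the bounds 4, 8, 16, 32 -/

section

variable {D : SlopeData} (U : HasUnitSlope D)

include U

/-- A nontrivial element displaces some interval. -/
theorem exists_displaced {f : bieriStrebelT D} (hf : f ≠ 1) :
    ∃ p ∈ D.A, ∃ q ∈ D.A, 0 < p ∧ p < q ∧ q < 1 ∧ ∀ x : UnitIco, p < x → (x : ℝ) < q →
      p < ((f : Equiv.Perm UnitIco) x : ℝ) → ¬ ((f : Equiv.Perm UnitIco) x : ℝ) < q := by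
  obtain ⟨x, hx⟩ : ∃ x, (f : Equiv.Perm UnitIco) x ≠ x := by
    by_contra h
    push Not at h
    exact hf (Subtype.ext (Equiv.ext h))
  obtain ⟨a, b, -, -, hax, hxb, hb1, c, -, d, -, hcd⟩ := IsAffineExchange.exists_right f.2.2 x
  set δ : ℝ := |((f : Equiv.Perm UnitIco) x : ℝ) - x| with hδ
  have hδ0 : 0 < δ := abs_pos.2 (sub_ne_zero.2 fun h => hx (Subtype.ext h))
  have hc0 : (0 : ℝ) < c := c.2
  have ht : 0 < δ / (c + 1) := div_pos hδ0 (by linarith)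
  -- With `t = δ / (c + 1)`: if `y` and `f y` both lay within `t` to the right of `x`, then `δ = |f
  -- x - x|` would be less than `c t + t = δ`.
  obtain ⟨p, hp, hp1, hp2⟩ := exists_mem_between U
    (lt_min hxb (lt_add_of_pos_right (x : ℝ) ht))
  obtain ⟨q, hq, hq1, hq2⟩ := exists_mem_between U hp2
  have hq3 := lt_min_iff.1 hq2
  have hx0 := x.2.1
  refine ⟨p, hp, q, hq, by linarith, hq1, by linarith, fun y hy1 hy2 hy3 hy4 => ?_⟩
  have e1 := hcd x hax hxb
  have e2 := hcd y (by linarith) (by linarith)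
  have h1 : δ < δ := by
    have h2 : δ ≤ (c : ℝ) * (y - x) + (((f : Equiv.Perm UnitIco) y : ℝ) - x) := by
      rw [hδ, abs_le']
      have h5 : (c : ℝ) * (y - x) = (f : Equiv.Perm UnitIco) y - (f : Equiv.Perm UnitIco) x := by
        rw [e1, e2]; ring
      have h6 : 0 ≤ (c : ℝ) * (y - x) := mul_nonneg hc0.le (by linarith)
      exact ⟨by linarith, by linarith⟩
    have h3 : (c : ℝ) * (y - x) < c * (δ / (c + 1)) :=
      mul_lt_mul_of_pos_left (by linarith [hq3.2]) hc0
    have h4 : (c : ℝ) * (δ / (c + 1)) + δ / (c + 1) = δ := by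
      field_simp
    linarith [hq3.2]
  exact lt_irrefl _ h1

/-- Conjugate `g` and `h` so that their supports lie in an interval displaced by `f`. There
`IsConjProduct.commutator` applies, and the count of four survives conjugating back. -/
theorem isConjProduct_commutator {f : bieriStrebelT D} (hf : f ≠ 1) {g h : unitStab D}
    (hg : (g : plGroup D) ∈ innerGroup D) (hh : (h : plGroup D) ∈ innerGroup D) :
    IsConjProduct f 4 (unitHom D ⁅g, h⁆) := by
  obtain ⟨p, hp, q, hq, hp0, hpq, hq1, hdisp⟩ := exists_displaced U hf
  obtain ⟨u, v, hu, hv, hu0, huv, hv1, hgs, hhs⟩ : ∃ u v : ℝ, u ∈ D.A ∧ v ∈ D.A ∧ 0 < u ∧ u < v ∧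
      v < 1 ∧ (∀ x, x ≤ u ∨ v ≤ x → (g : ℝ ≃o ℝ) x = x) ∧
      ∀ x, x ≤ u ∨ v ≤ x → (h : ℝ ≃o ℝ) x = x := by
    obtain ⟨u₁, v₁, h1, h2, h3, h4⟩ := hg
    obtain ⟨u₂, v₂, h5, h6, h7, h8⟩ := hh
    obtain ⟨u, hu, hu1, hu2⟩ := exists_mem_between U (lt_min h1 h5)
    obtain ⟨v, hv, hv1, hv2⟩ := exists_mem_between U (max_lt h3 h7)
    have := lt_min_iff.1 hu2
    have := max_lt_iff.1 hv1
    exact ⟨u, v, hu, hv, hu1, by linarith, hv2,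
      fun x hx => h4 x (hx.imp (fun h => by linarith) fun h => by linarith),
      fun x hx => h8 x (hx.imp (fun h => by linarith) fun h => by linarith)⟩
  obtain ⟨s, hs, hsu, hsv⟩ := exists_interpolating U hu hv hp hq huv hpq
  obtain ⟨k, hk, hk1, hk2⟩ := exists_cutoff U hs D.A.zero_mem hu hv D.one_mem hu0 huv.le hv1
    (hsu ▸ hp0) (hsv ▸ hq1)
  have hku : k u = p := by rw [hk2 u le_rfl huv.le, hsu]
  have hkv : k v = q := by rw [hk2 v huv.le le_rfl, hsv]
  let κ : unitStab D := ⟨⟨k, hk⟩, hk1 0 (Or.inl le_rfl), hk1 1 (Or.inr le_rfl)⟩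
  have hsupp : ∀ g : unitStab D, (∀ x, x ≤ u ∨ v ≤ x → (g : ℝ ≃o ℝ) x = x) →
      ∀ x : UnitIco, (x : ℝ) ≤ p ∨ q ≤ x → (unitHom D (κ * g * κ⁻¹) : Equiv.Perm UnitIco) x = x := by
    intro g hg x hx
    rw [← hku, ← hkv] at hx
    exact Subtype.ext (supp_conj (w := k) hg x hx)
  have hgs' := hsupp g⁻¹ fun x hx => ((g : ℝ ≃o ℝ).symm_apply_eq).2 (hgs x hx).symm
  have hhs' := hsupp h hhs
  set g' := unitHom D (κ * g * κ⁻¹) with hg'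
  set h' := unitHom D (κ * h * κ⁻¹) with hh'
  have hginv : unitHom D (κ * g⁻¹ * κ⁻¹) = g'⁻¹ := by
    rw [hg', ← map_inv]
    exact congrArg _ (by group)
  rw [hginv] at hgs'
  have hcomm : Commute (f * g'⁻¹ * f⁻¹) h' := by
    apply Subtype.ext
    refine Equiv.Perm.Disjoint.commute fun x => ?_
    by_cases hx : (x : ℝ) ≤ p ∨ q ≤ x
    · exact Or.inr (hhs' x hx)
    · left
      push Not at hx
      set y : UnitIco := (f : Equiv.Perm UnitIco)⁻¹ x with hy
      have hfy : (f : Equiv.Perm UnitIco) y = x := by simp [hy]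
      have hyo : (y : ℝ) ≤ p ∨ q ≤ y := by
        by_contra hcon
        push Not at hcon
        exact hdisp y hcon.1 hcon.2 (by rw [hfy]; exact hx.1) (by rw [hfy]; exact hx.2)
      change (f : Equiv.Perm UnitIco) ((g'⁻¹ : bieriStrebelT D) |>.1 y) = x
      rw [hgs' y hyo, hfy]
  have h1 := (IsConjProduct.commutator hcomm).conj (unitHom D κ)⁻¹
  have h2 : (unitHom D κ)⁻¹ * ⁅g', h'⁆ * (unitHom D κ)⁻¹⁻¹ = unitHom D ⁅g, h⁆ := by
    rw [hg', hh', ← map_commutatorElement, ← map_inv, ← map_inv, ← map_mul, ← map_mul]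
    congr 1
    simp only [commutatorElement_def]
    group
  rwa [h2] at h1

theorem isConjProduct_inner (hA : IsLocallyCyclic D) {f : bieriStrebelT D} (hf : f ≠ 1)
    {b : unitStab D} (hb : (b : plGroup D) ∈ innerGroup D) : IsConjProduct f 8 (unitHom D b) := by
  obtain ⟨g₁, hg₁, h₁, hh₁, g₂, hg₂, h₂, hh₂, e⟩ := exists_inner_two_commutators U hA hb
  have hle := innerGroup_le_unitStab D
  have e' : b = ⁅(⟨g₁, hle hg₁⟩ : unitStab D), ⟨h₁, hle hh₁⟩⁆ *
      ⁅(⟨g₂, hle hg₂⟩ : unitStab D), ⟨h₂, hle hh₂⟩⁆ := Subtype.ext e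
  rw [e', map_mul]
  exact (isConjProduct_commutator U hf (g := ⟨g₁, hle hg₁⟩) (h := ⟨h₁, hle hh₁⟩) hg₁ hh₁).mul
    (isConjProduct_commutator U hf (g := ⟨g₂, hle hg₂⟩) (h := ⟨h₂, hle hh₂⟩) hg₂ hh₂)

/-- The germs at the end points of a homeomorphism of `[0, 1]` are those at an interior point of a
homeomorphism of compact support. -/
theorem exists_inner_germ {x : ℝ} (hx : x ∈ D.A) (hx0 : 0 < x) (hx1 : x < 1) (g : unitStab D) :
    ∃ k : unitStab D, (k : plGroup D) ∈ innerGroup D ∧ (k : ℝ ≃o ℝ) x = x ∧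
      ∃ δ > 0, (∀ y, 0 ≤ y → y < δ → (k : ℝ ≃o ℝ) (x + y) = x + (g : ℝ ≃o ℝ) y ∧
          x + y < 1 ∧ x + (g : ℝ ≃o ℝ) y < 1) ∧
        ∀ y, 1 - δ < y → y ≤ 1 → (k : ℝ ≃o ℝ) (x + y - 1) = x + (g : ℝ ≃o ℝ) y - 1 ∧
          0 < x + y - 1 ∧ 0 < x + (g : ℝ ≃o ℝ) y - 1 := by
  obtain ⟨c, hc, d, hd, hcd⟩ := (g.1.2 0).1
  obtain ⟨c', hc', d', hd', hcd'⟩ := (g.1.2 1).2.1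
  have hd0 : d = 0 := by
    have := hcd.self_of_nhdsWithin self_mem_Ici
    rw [g.2.1] at this
    linarith
  have hd1 : d' = 1 - c' := by
    have := hcd'.self_of_nhdsWithin self_mem_Iic
    rw [g.2.2] at this
    linarith
  obtain ⟨ε, hε, hgε⟩ := mem_nhdsGE_iff_exists_Ico_subset.1 hcd
  obtain ⟨ε', hε', hgε'⟩ := mem_nhdsLE_iff_exists_Ioc_subset.1 hcd'
  simp only [mem_Ioi, mem_Iio] at hε hε'
  have hglue : affineIso c' (x - c' * x) x = affineIso c (x - c * x) x := by simp
  -- On the circle, the left side of `0` is the left side of `1`. So `s` has the slope of `g` at `1`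
  -- to the left of `x` and the slope of `g` at `0` to the right of `x`.
  set s : ℝ ≃o ℝ := glueIso _ _ x hglue with hs_def
  have hs : s ∈ plGroup D := glueIso_mem
    (affineIso_mem hc' (D.A.sub_mem hx (D.smul_mem _ hc' _ hx)))
    (affineIso_mem hc (D.A.sub_mem hx (D.smul_mem _ hc _ hx))) hx
  have hsr : ∀ y ≥ x, s y = c * y + (x - c * x) := fun y hy => glueIso_of_ge hy
  have hsl : ∀ y ≤ x, s y = c' * y + (x - c' * x) := fun y hy => glueIso_of_le hy
  have hsx : s x = x := by rw [hsr x le_rfl]; ring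
  obtain ⟨a, ha, ha1, ha2⟩ := exists_mem_between U (max_lt hx0
    ((s.symm_apply_lt).2 (by rwa [hsx]) : s.symm 0 < x))
  obtain ⟨b, hb, hb1, hb2⟩ := exists_mem_between U (lt_min hx1
    ((s.lt_symm_apply).2 (by rwa [hsx]) : x < s.symm 1))
  have ha3 := max_lt_iff.1 ha1
  have hb3 := lt_min_iff.1 hb2
  have hsa : 0 < s a := (s.symm_apply_lt).1 ha3.2
  have hsb : s b < 1 := (s.lt_symm_apply).1 hb3.2
  obtain ⟨u, hu, hu1, hu2⟩ := exists_mem_between U (lt_min ha3.1 hsa)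
  obtain ⟨v, hv, hv1, hv2⟩ := exists_mem_between U (max_lt hb3.1 hsb)
  have hu3 := lt_min_iff.1 hu2
  have hv3 := max_lt_iff.1 hv1
  obtain ⟨k, hk, hk1, hk2⟩ := exists_cutoff U hs hu ha hb hv hu3.1 (by linarith) hv3.1 hu3.2 hv3.2
  refine ⟨⟨⟨k, hk⟩, hk1 0 (Or.inl hu1.le), hk1 1 (Or.inr hv2.le)⟩,
    ⟨u, v, hu1, by linarith, hv2, hk1⟩, ?_, min (min ε (1 - ε')) (min (x - a) (b - x)), ?_, ?_, ?_⟩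
  · exact (hk2 x ha2.le hb1.le).trans hsx
  · exact lt_min (lt_min hε (by linarith)) (lt_min (by linarith) (by linarith))
  · intro y hy0 hy
    simp only [lt_min_iff] at hy
    have e1 : (g : ℝ ≃o ℝ) y = c * y + d := hgε ⟨hy0, hy.1.1⟩
    have e2 : k (x + y) = s (x + y) := hk2 _ (by linarith) (by linarith)
    have e3 := hsr (x + y) (by linarith)
    have e4 : s (x + y) ≤ s b := s.monotone (by linarith)
    have e5 : s (x + y) = x + (g : ℝ ≃o ℝ) y := by rw [e3, e1, hd0]; ring
    exact ⟨e2.trans e5, by linarith, by linarith⟩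
  · intro y hy hy1
    have hy' := sub_lt_comm.1 hy
    simp only [lt_min_iff] at hy'
    have e1 : (g : ℝ ≃o ℝ) y = c' * y + d' := hgε' ⟨by linarith, hy1⟩
    have e2 : k (x + y - 1) = s (x + y - 1) := hk2 _ (by linarith) (by linarith)
    have e3 := hsl (x + y - 1) (by linarith)
    have e4 : s a ≤ s (x + y - 1) := s.monotone (by linarith)
    have e5 : s (x + y - 1) = x + (g : ℝ ≃o ℝ) y - 1 := by rw [e3, e1, hd1]; ring
    exact ⟨e2.trans e5, by linarith, by linarith⟩

/-- A rotation carries `0` to an interior point `x`, where the germ of `g` is realised by a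
compactly supported `k`. The rotated copy `ψ` of `k` agrees with `g` near `0`, so `ψ⁻¹ g` is
supported inside `(0, 1)`. Each of the two factors costs 8. -/
theorem isConjProduct_unitHom (hA : IsLocallyCyclic D) {f : bieriStrebelT D} (hf : f ≠ 1)
    (g : unitStab D) : IsConjProduct f 16 (unitHom D g) := by
  obtain ⟨x, hx, hx0, hx1⟩ := exists_mem_between U one_pos
  obtain ⟨k, hk, hkx, δ, hδ, hr, hl⟩ := exists_inner_germ U hx hx0 hx1 g
  set r : bieriStrebelT D := circleRotation ⟨x, hx⟩ with hr_def
  set ψ : bieriStrebelT D := r⁻¹ * unitHom D k * r with hψ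
  have hψg : ∀ y : UnitIco, (y : ℝ) < δ ∨ 1 - δ < y →
      ((ψ⁻¹ * unitHom D g : bieriStrebelT D) : Equiv.Perm UnitIco) y = y := by
    intro y hy
    have hy0 := y.2.1
    have hg0 := ((unitHom D g : Equiv.Perm UnitIco) y).2
    rw [unitHom_apply] at hg0
    have key : (unitHom D k : Equiv.Perm UnitIco) ((r : Equiv.Perm UnitIco) y)
        = (r : Equiv.Perm UnitIco) ((unitHom D g : Equiv.Perm UnitIco) y) := by
      apply Subtype.ext
      rw [unitHom_apply, circleRotation_apply, circleRotation_apply, unitHom_apply]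
      rcases hy with hy | hy
      · obtain ⟨h1, h2, h3⟩ := hr y hy0 hy
        rw [add_comm (y : ℝ), add_comm ((g : ℝ ≃o ℝ) y), Int.fract_eq_self.2 ⟨by linarith, h2⟩,
          Int.fract_eq_self.2 ⟨by linarith [hg0.1], h3⟩, h1]
      · obtain ⟨h1, h2, h3⟩ := hl y hy y.2.2.le
        rw [add_comm (y : ℝ), add_comm ((g : ℝ ≃o ℝ) y), ← Int.fract_sub_one,
          ← Int.fract_sub_one (x + (g : ℝ ≃o ℝ) y),
          Int.fract_eq_self.2 ⟨h2.le, by linarith [y.2.2]⟩,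
          Int.fract_eq_self.2 ⟨h3.le, by linarith [hg0.2]⟩, h1]
    change (ψ : Equiv.Perm UnitIco)⁻¹ ((unitHom D g : Equiv.Perm UnitIco) y) = y
    rw [Equiv.Perm.inv_eq_iff_eq]
    change _ = (r : Equiv.Perm UnitIco)⁻¹ ((unitHom D k : Equiv.Perm UnitIco)
      ((r : Equiv.Perm UnitIco) y))
    rw [key]
    simp
  obtain ⟨b, hb, hb'⟩ := exists_unitHom_eq (hψg ⟨0, by simp⟩ (Or.inl hδ))
  have hbin : (b : plGroup D) ∈ innerGroup D := by
    -- The bounds `1/3` and `2/3` only ensure that the left end is below the right end when `δ` is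
    -- large.
    refine ⟨min (δ / 2) (1 / 3), max (1 - δ / 2) (2 / 3), by positivity, ?_, ?_, fun y hy => ?_⟩
    · exact (min_le_right _ _).trans_lt (lt_of_lt_of_le (by norm_num) (le_max_right _ _))
    · exact max_lt (by linarith) (by norm_num)
    · by_cases hyI : y ∈ Ico (0 : ℝ) 1
      · have h1 : y < δ ∨ 1 - δ < y := by
          rcases hy with hy | hy
          · exact Or.inl (by linarith [le_min_iff.1 hy])
          · exact Or.inr (by linarith [max_le_iff.1 hy])
        have h2 := hψg ⟨y, hyI⟩ h1
        rw [← hb] at h2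
        exact congrArg Subtype.val h2
      · refine hb' y ?_
        by_contra hcon
        push Not at hcon
        exact hyI ⟨hcon.1.le, hcon.2⟩
  have h1 := (isConjProduct_inner U hA hf hk).conj r⁻¹
  have h2 := h1.mul (isConjProduct_inner U hA hf hbin)
  convert h2 using 1
  rw [hb, hψ]
  group

/-- The Bieri-Strebel groups of the circle of this kind are uniformly simple. -/
theorem isUniformlySimple_bieriStrebelT (hA : IsLocallyCyclic D) :
    IsUniformlySimple (bieriStrebelT D) := by
  -- Choose `x ∈ A` other than `0` and `φ 0`, so that `φ⁻¹ x` is not `0`. Some `κ` fixing `0` moves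
  -- `x` to `φ⁻¹ x`. Then `φ κ` fixes `x`, and a rotation makes it fix `0`; both `φ κ` and `κ⁻¹`
  -- cost 16.
  refine ⟨32, by norm_num, fun f φ hf _ => ?_⟩
  obtain ⟨x, hx, hx0, hx1, hxφ⟩ : ∃ x ∈ D.A, 0 < x ∧ x < 1 ∧
      x ≠ (φ : Equiv.Perm UnitIco) ⟨0, by simp⟩ := by
    obtain ⟨x, hx, hx0, hx1⟩ := exists_mem_between U one_pos
    obtain ⟨y, hy, hy0, hy1⟩ := exists_mem_between U hx0
    by_cases h : x = (φ : Equiv.Perm UnitIco) ⟨0, by simp⟩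
    · exact ⟨y, hy, hy0, by linarith, by rw [← h]; exact hy1.ne⟩
    · exact ⟨x, hx, hx0, hx1, h⟩
  set x' : UnitIco := ⟨x, hx0.le, hx1⟩ with hx'
  set y : UnitIco := (φ : Equiv.Perm UnitIco)⁻¹ x' with hy
  have hφy : (φ : Equiv.Perm UnitIco) y = x' := by simp [hy]
  have hyA : (y : ℝ) ∈ D.A := IsAffineExchange.mem_of_image_mem φ.2.2 y (by rw [hφy]; exact hx)
  have hy0 : 0 < (y : ℝ) := by
    refine lt_of_le_of_ne y.2.1 fun h => hxφ ?_
    have : y = ⟨0, by simp⟩ := Subtype.ext h.symm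
    rw [← this, hφy]
  have hval : affineIso 1 ((y : ℝ) - x) x = y := by simp
  obtain ⟨k, hk, hk1, hk2⟩ := exists_cutoff U
    (affineIso_mem D.Λ.one_mem (D.A.sub_mem hyA hx)) D.A.zero_mem hx hx D.one_mem hx0 le_rfl hx1
    (by rw [hval]; exact hy0) (by rw [hval]; exact y.2.2)
  let κ : unitStab D := ⟨⟨k, hk⟩, hk1 0 (Or.inl le_rfl), hk1 1 (Or.inr le_rfl)⟩
  have hκ : (unitHom D κ : Equiv.Perm UnitIco) x' = y :=
    Subtype.ext ((hk2 x le_rfl le_rfl).trans hval)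
  set r : bieriStrebelT D := circleRotation ⟨x, hx⟩ with hr
  have hr0 : (r : Equiv.Perm UnitIco) ⟨0, by simp⟩ = x' := by
    apply Subtype.ext
    rw [circleRotation_apply, zero_add]
    exact Int.fract_eq_self.2 ⟨hx0.le, hx1⟩
  have hfix : ((r⁻¹ * (φ * unitHom D κ) * r : bieriStrebelT D) : Equiv.Perm UnitIco) ⟨0, by simp⟩
      = ⟨0, by simp⟩ := by
    change (r : Equiv.Perm UnitIco)⁻¹ ((φ : Equiv.Perm UnitIco) ((unitHom D κ : Equiv.Perm UnitIco)
      ((r : Equiv.Perm UnitIco) ⟨0, by simp⟩))) = ⟨0, by simp⟩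
    rw [hr0, hκ, hφy, ← hr0]
    simp
  obtain ⟨g, hg, -⟩ := exists_unitHom_eq hfix
  have h1 := ((isConjProduct_unitHom U hA hf g).conj r).mul (isConjProduct_unitHom U hA hf κ⁻¹)
  have e : φ = r * unitHom D g * r⁻¹ * unitHom D κ⁻¹ := by
    rw [hg, map_inv]
    group
  rw [← e] at h1
  exact h1

end

/-! ### Arithmetic of the slope data -/

/-- The fractions whose denominator is a power of `N`. -/
def fractionSubring (N : ℕ) : Subring ℝ where
  carrier := {a | ∃ (m : ℤ) (k : ℕ), a * (N : ℝ) ^ k = m}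
  mul_mem' := by
    rintro a b ⟨m, k, h⟩ ⟨m', k', h'⟩
    exact ⟨m * m', k + k', by rw [pow_add, mul_mul_mul_comm, h, h']; push_cast; rfl⟩
  one_mem' := ⟨1, 0, by simp⟩
  add_mem' := by
    rintro a b ⟨m, k, h⟩ ⟨m', k', h'⟩
    refine ⟨m * N ^ k' + m' * N ^ k, k + k', ?_⟩
    push_cast
    rw [← h, ← h']
    ring
  zero_mem' := ⟨0, 0, by simp⟩
  neg_mem' := by
    rintro a ⟨m, k, h⟩
    exact ⟨-m, k, by rw [neg_mul, h]; push_cast; rfl⟩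

/-- Two fractions over powers of `N` have a common denominator `N ^ (k + k')`, whose inverse is in
`A`. -/
theorem isLocallyCyclic_of_fractions {D : SlopeData} {N : ℕ} (hN : N ≠ 0)
    (h : ∀ k : ℕ, ((N : ℝ)⁻¹) ^ k ∈ D.A) (hle : ∀ a ∈ D.A, a ∈ fractionSubring N) :
    IsLocallyCyclic D := by
  intro a ha b hb
  obtain ⟨m, k, hm⟩ := hle a ha
  obtain ⟨m', k', hm'⟩ := hle b hb
  have hN' : (N : ℝ) ≠ 0 := by exact_mod_cast hN
  refine ⟨_, h (k + k'), m * N ^ k', m' * N ^ k, ?_, ?_⟩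
  · push_cast
    rw [← hm, inv_pow, pow_add]
    field_simp
  · push_cast
    rw [← hm', inv_pow, pow_add]
    field_simp

theorem isUniformlySimple_brownThompsonT_two : IsUniformlySimple (brownThompsonT 2) := by
  have hmem : (⟨2, two_pos⟩ : PosReal) ∈ (brownSlopeData 2).Λ :=
    Subgroup.subset_closure (by simp)
  refine isUniformlySimple_bieriStrebelT ⟨⟨2, two_pos⟩, hmem, one_lt_two, fun a ha => ?_⟩ ?_
  · norm_num
    exact ha
  · refine isLocallyCyclic_of_fractions (N := 2) two_ne_zero (fun k => ?_) fun a ha => ?_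
    · refine Subring.pow_mem _ (Subring.subset_closure ?_) k
      simp
    · refine (Subring.closure_le (t := fractionSubring 2)).2 ?_ ha
      rintro x rfl
      exact ⟨1, 1, by norm_num⟩

theorem mem_steinSlopeData {p : ℕ} {n : Fin p → ℕ} (i : Fin p) (h : 0 < (n i : ℝ)) :
    (⟨n i, h⟩ : PosReal) ∈ (steinSlopeData n).Λ := Subgroup.subset_closure ⟨i, rfl⟩

section stein

variable {p : ℕ} {n : Fin p → ℕ} (hn : ∀ i, 1 < n i)

include hn

/-- One denominator serves for all: each `1 / n i` is an integer over `N = ∏ n i`, and `1 / N` is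
itself in `Λ`. -/
theorem isLocallyCyclic_steinSlopeData : IsLocallyCyclic (steinSlopeData n) := by
  have hpos : ∀ i, 0 < (n i : ℝ) := fun i => by exact_mod_cast (hn i).le.trans_lt' one_pos
  have hN : ∏ i, n i ≠ 0 := Finset.prod_ne_zero_iff.2 fun i _ => (zero_lt_one.trans (hn i)).ne'
  have hprod : ∀ s : Finset (Fin p), ∃ c ∈ (steinSlopeData n).Λ, (c : ℝ) = ∏ i ∈ s, (n i : ℝ) := by
    classical
    intro s
    induction s using Finset.induction_on with
    | empty => exact ⟨1, Subgroup.one_mem _, by simp⟩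
    | insert i s hi ih =>
      obtain ⟨c, hc, e⟩ := ih
      exact ⟨_, Subgroup.mul_mem _ (mem_steinSlopeData i (hpos i)) hc, by
        rw [Finset.prod_insert hi, Positive.val_mul, e]⟩
  have hΛ : ∀ c ∈ (steinSlopeData n).Λ, (c : ℝ) ∈ fractionSubring (∏ i, n i) ∧
      ((c⁻¹ : PosReal) : ℝ) ∈ fractionSubring (∏ i, n i) := by
    intro c hc
    change c ∈ Subgroup.closure _ at hc
    induction hc using Subgroup.closure_induction with
    | mem x hx =>
      obtain ⟨i, hi⟩ := hx
      refine ⟨hi ▸ natCast_mem _ _, (∏ j ∈ Finset.univ.erase i, n j : ℕ), 1, ?_⟩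
      rw [Positive.coe_inv, hi, pow_one, ← Finset.mul_prod_erase _ _ (Finset.mem_univ i)]
      push_cast
      rw [inv_mul_cancel_left₀ (hpos i).ne']
    | one => simp
    | mul x y _ _ hx hy =>
      rw [mul_inv, Positive.val_mul, Positive.val_mul]
      exact ⟨Subring.mul_mem _ hx.1 hy.1, Subring.mul_mem _ hx.2 hy.2⟩
    | inv x _ hx => exact ⟨hx.2, by rw [inv_inv]; exact hx.1⟩
  refine isLocallyCyclic_of_fractions hN (fun k => ?_) fun a ha => ?_
  · obtain ⟨c, hc, e⟩ := hprod Finset.univ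
    have h := (steinSlopeData n).smul_mem _ (Subgroup.inv_mem _ hc) 1 (steinSlopeData n).one_mem
    rw [Positive.coe_inv, e, mul_one, ← Nat.cast_prod] at h
    exact Subring.pow_mem _ h k
  · refine (Subring.closure_le (t := fractionSubring (∏ i, n i))).2 ?_ ha
    rintro x ⟨c, hc, rfl⟩
    exact (hΛ c hc).1

/-- The unit slope is `l = n i ^ (2 * k)`: then `l - 1 = n j` is in `Λ`, so dividing by it preserves
`A`. -/
theorem isUniformlySimple_steinThompsonT {i j : Fin p} {k : ℕ} (hk : 1 ≤ k)
    (h : n j = n i ^ (2 * k) - 1) : IsUniformlySimple (steinThompsonT n) := by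
  have hpos : ∀ i, 0 < (n i : ℝ) := fun i => by exact_mod_cast (hn i).le.trans_lt' one_pos
  have hone : 1 < n i ^ (2 * k) := Nat.one_lt_pow (by omega) (hn i)
  have hj : (n i : ℝ) ^ (2 * k) - 1 = n j := by
    rw [h, Nat.cast_sub hone.le]
    push_cast
    rfl
  refine isUniformlySimple_bieriStrebelT ⟨⟨n i, hpos i⟩ ^ (2 * k),
    Subgroup.pow_mem _ (mem_steinSlopeData i (hpos i)) _, ?_, fun a ha => ?_⟩
    (isLocallyCyclic_steinSlopeData hn)
  · rw [Positive.val_pow]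
    change (1 : ℝ) < (n i : ℝ) ^ (2 * k)
    exact_mod_cast hone
  · have := (steinSlopeData n).smul_mem _
      (Subgroup.inv_mem _ (mem_steinSlopeData j (hpos j))) a ha
    rw [Positive.coe_inv] at this
    rw [Positive.val_pow, hj, div_eq_inv_mul]
    exact this

end stein

theorem corollary1p14 :
    IsUniformlySimple (brownThompsonT 2) ∧
    (∀ (p k : ℕ) (n : Fin (p + 2) → ℕ), IsSteinTuple n → 1 ≤ k → n 1 = n 0 ^ (2 * k) - 1 →
      IsUniformlySimple (steinThompsonT n)) ∧
    (∀ (p : ℕ) (n : Fin (p + 2) → ℕ), IsSteinTuple n → n 0 = 2 → n 1 = 3 →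
      IsUniformlySimple (steinThompsonT n)) := by
  refine ⟨isUniformlySimple_brownThompsonT_two, fun p k n hn hk h =>
    isUniformlySimple_steinThompsonT hn.1 hk h, fun p n hn h0 h1 =>
    isUniformlySimple_steinThompsonT hn.1 (i := 0) (j := 1) le_rfl ?_⟩
  rw [h0, h1]
  norm_num
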